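/- Let $L>0$, let $h:\mathbb R\to(0,\infty)$ be smooth and $L$-periodic, and put $\Omega=\{(x_1,x_2):0<x_1<L,\ 0<x_2<h(x_1)\}$, with bottom $\Gamma_0=\{x_2=0\}$ and top $\Gamma_1=\{x_2=h(x_1)\}$. Let $\nu>0$, $k>0$, $U_0\in\mathbb R$, and let $\xi=U(x_2)e_1$ be a smooth background flow with $U(0)=U_0$, $U(h(x_1))=0$ for $x_1\in(0,L)$, and $U'(0)=0$. Let $\tilde V$ be the set of vector fields $v$ that are smooth up to the boundary, $L$-periodic in $x_1$, divergence free in $\Omega$, and satisfy $v=0$ on $\Gamma_1$ and $v\cdot n=0$ on $\Gamma_0$. Let $H$ and $V$ be the closures of $\tilde V$ in $L^2(\Omega)^2$ and in $H^1(\Omega)^2$, let $V'$ be the dual of $V$ (with $V\subset H\subset V'$), let $(\cdot,\cdot)$ and $|\cdot|$ be the scalar product and the norm of $L^2(\Omega)$, and set $$a(u,v)=(\nabla u,\nabla v),\quad b(u,v,w)=((u\cdot\nabla)v,w),\quad j(u)=\int_{\Gamma_0}k|u(x_1,0)|\,dx_1,$$ $$(\mathcal L(v),\Theta)=-\nu a(\xi,\Theta)-b(\xi,v,\Theta)-b(v,\xi,\Theta).$$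 Given $v_0\in H$, a solution with initial value $v_0$ is a function $v:[0,\infty)\to H$ such that $v(0)=v_0$; for all $T>0$, $v\in C([0,T];H)\cap L^2(0,T;V)$ with $v_t\in L^2(0,T;V')$; and for all $\Theta\in V$, all $T>0$ and almost all $t\in(0,T)$, $$\langle v_t(t),\Theta-v(t)\rangle+\nu a(v(t),\Theta-v(t))+b(v(t),v(t),\Theta-v(t))+j(\Theta)-j(v(t))\ge(\mathcal L(v(t)),\Theta-v(t)).$$ Theorem. For every $v_0\in H$ there is at most one solution with initial value $v_0$. Moreover, the map $v(\tau)\mapsto v(t)$, $t>\tau\ge0$, is Lipschitz continuous in $H$, uniformly for $\tau,t$ in bounded intervals and for initial values in bounded sets: for every $T>0$ and every bounded set $B\subset H$ there is a constant $C$ such that any two solutions $v,w$ with $v(0),w(0)\in B$ satisfy $$|w(t)-v(t)|\le C\,|w(\tau)-v(\tau)|\qquad\text{for all }0\le\tau<t\le T.$$ -/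

import Mathlib

open MeasureTheory Set
open scoped ContDiff

noncomputable section

/-- Vectors in the plane, with the Euclidean norm. -/
abbrev Vec2 : Type := EuclideanSpace ℝ (Fin 2)

/-- `2 × 2` matrices, with the Frobenius inner product. -/
abbrev Mat2 : Type := EuclideanSpace ℝ (Fin 2 × Fin 2)

/-- The two coordinate directions of the plane `ℝ × ℝ` of points `(x₁, x₂)`. -/
def coordDir : Fin 2 → ℝ × ℝ := ![(1, 0), (0, 1)]

/-- The classical gradient of a vector field: the entry `(i, j)` is `∂ φᵢ / ∂ xⱼ`. -/
def gradField (φ : ℝ × ℝ → Vec2) (x : ℝ × ℝ) : Mat2 :=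
  WithLp.toLp 2 fun p => fderiv ℝ φ x (coordDir p.2) p.1

/-- The geometric data of the flow domain: a period `L > 0` and a positive, smooth, `L`-periodic
height function `h`. -/
structure PeriodicChannel where
  L : ℝ
  h : ℝ → ℝ
  L_pos : 0 < L
  h_smooth : ContDiff ℝ ∞ h
  h_pos : ∀ x, 0 < h x
  h_periodic : Function.Periodic h L

namespace PeriodicChannel

variable (D : PeriodicChannel)

/-- The infinite channel `Ω_∞`. -/
def strip : Set (ℝ × ℝ) := {x | 0 < x.2 ∧ x.2 < D.h x.1}

/-- The flow domain `Ω`, one period of the channel. -/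
def dom : Set (ℝ × ℝ) := {x | 0 < x.1 ∧ x.1 < D.L ∧ 0 < x.2 ∧ x.2 < D.h x.1}

/-- Lebesgue measure on `Ω`. -/
abbrev mu : Measure (ℝ × ℝ) := volume.restrict D.dom

/-- The space `Ṽ`: vector fields that are smooth up to the boundary of the channel (that is,
restrictions of smooth fields on the plane), `L`-periodic in `x₁`, divergence free in the channel,
zero on the top `Γ₁` and with zero normal component on the bottom `Γ₀`. -/
def testSpace : Submodule ℝ (ℝ × ℝ → Vec2) where
  carrier := {φ | ContDiff ℝ ∞ φ ∧ (∀ x₁ x₂, φ (x₁ + D.L, x₂) = φ (x₁, x₂)) ∧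
    (∀ x ∈ D.strip, ∑ i, gradField φ x (i, i) = 0) ∧
    (∀ x₁, φ (x₁, D.h x₁) = 0) ∧ (∀ x₁, φ (x₁, 0) 1 = 0)}
  zero_mem' := by
    refine ⟨contDiff_const, fun _ _ => rfl, fun x _ => ?_, fun _ => rfl, fun _ => rfl⟩
    simp [gradField]
  add_mem' := by
    rintro φ ψ ⟨h1, h2, h3, h4, h5⟩ ⟨k1, k2, k3, k4, k5⟩
    refine ⟨h1.add k1, fun x y => ?_, fun x hx => ?_, fun x => ?_, fun x => ?_⟩
    · simp [h2, k2]
    · have e := congrArg₂ (· + ·) (h3 x hx) (k3 x hx)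
      have d : fderiv ℝ (φ + ψ) x = fderiv ℝ φ x + fderiv ℝ ψ x :=
        fderiv_add (h1.differentiable (by simp) x) (k1.differentiable (by simp) x)
      simp only [gradField, d, Fin.sum_univ_two, _root_.add_apply,
        PiLp.add_apply] at e ⊢
      linarith
    · simp [h4, k4]
    · simp [h5, k5]
  smul_mem' := by
    rintro c φ ⟨h1, h2, h3, h4, h5⟩
    refine ⟨contDiff_const.smul h1, fun x y => ?_, fun x hx => ?_, fun x => ?_, fun x => ?_⟩
    · simp [h2]
    · have e := congrArg (c * ·) (h3 x hx)
      have d : fderiv ℝ (c • φ) x = c • fderiv ℝ φ x :=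
        fderiv_const_smul (h1.differentiable (by simp) x) c
      simp only [gradField, d, Fin.sum_univ_two, _root_.smul_apply,
        PiLp.smul_apply, smul_eq_mul] at e ⊢
      linarith
    · simp [h4]
    · simp [h5]

theorem dom_bounded : ∃ K : Set (ℝ × ℝ), IsCompact K ∧ D.dom ⊆ K := by
  obtain ⟨M, hM⟩ := isCompact_Icc.exists_bound_of_continuousOn
    (s := Icc 0 D.L) (f := D.h) D.h_smooth.continuous.continuousOn
  refine ⟨Icc 0 D.L ×ˢ Icc 0 M, isCompact_Icc.prod isCompact_Icc, ?_⟩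
  rintro x ⟨h1, h2, h3, h4⟩
  have := hM x.1 ⟨h1.le, h2.le⟩
  exact ⟨⟨h1.le, h2.le⟩, h3.le, h4.le.trans ((le_abs_self _).trans this)⟩

/-- A function continuous on the plane is square integrable on any subset of a compact set. -/
theorem memLp_of_continuous {X F : Type*} [TopologicalSpace X] [T2Space X]
    [SecondCountableTopology X]
    [MeasurableSpace X] [BorelSpace X] [NormedAddCommGroup F] {m : Measure X}
    [IsFiniteMeasureOnCompacts m] {s K : Set X} (hK : IsCompact K) (hs : s ⊆ K)
    {f : X → F} (hf : Continuous f) : MemLp f 2 (m.restrict s) := by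
  obtain ⟨M, hM⟩ := hK.exists_bound_of_continuousOn hf.continuousOn
  have : IsFiniteMeasure (m.restrict K) := ⟨by simpa using hK.measure_lt_top⟩
  refine MemLp.mono_measure (Measure.restrict_mono hs le_rfl) ?_
  refine MemLp.of_bound (hf.continuousOn.aestronglyMeasurable_of_isCompact hK hK.measurableSet) M ?_
  exact (ae_restrict_mem hK.measurableSet).mono fun x hx => hM x hx

/-- The space `L²(Ω)²`. -/
abbrev L2Vec : Type := Lp Vec2 2 D.mu

/-- The space `L²(Ω)^{2×2}`. -/
abbrev L2Mat : Type := Lp Mat2 2 D.mu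

/-- The Hilbert space `L²(Ω)² × L²(Ω)^{2×2}`, with `‖(v, G)‖² = |v|² + |G|²`. The space `H¹(Ω)²` is
isometric, through `v ↦ (v, ∇v)`, to the closed subspace of the pairs whose second component is
the weak gradient of the first. -/
abbrev H1Pair : Type := WithLp 2 (D.L2Vec × D.L2Mat)

theorem continuous_gradField {φ : ℝ × ℝ → Vec2} (hφ : ContDiff ℝ ∞ φ) :
    Continuous (gradField φ) := by
  have h := hφ.continuous_fderiv (by simp)
  unfold gradField
  fun_prop

theorem memLp_test (φ : D.testSpace) : MemLp (φ : ℝ × ℝ → Vec2) 2 D.mu := by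
  obtain ⟨K, hK, hs⟩ := D.dom_bounded
  exact memLp_of_continuous hK hs φ.2.1.continuous

theorem memLp_gradField_test (φ : D.testSpace) :
    MemLp (gradField (φ : ℝ × ℝ → Vec2)) 2 D.mu := by
  obtain ⟨K, hK, hs⟩ := D.dom_bounded
  exact memLp_of_continuous hK hs (continuous_gradField φ.2.1)

theorem memLp_bottom_test (φ : D.testSpace) :
    MemLp (fun x₁ : ℝ => (φ : ℝ × ℝ → Vec2) (x₁, 0)) 2 (volume.restrict (Ioo 0 D.L)) :=
  memLp_of_continuous isCompact_Icc Ioo_subset_Icc_self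
    (φ.2.1.continuous.comp (by fun_prop))

theorem gradField_add (φ ψ : D.testSpace) :
    gradField ((φ + ψ : D.testSpace) : ℝ × ℝ → Vec2) =
      gradField (φ : ℝ × ℝ → Vec2) + gradField (ψ : ℝ × ℝ → Vec2) := by
  funext x
  have d : fderiv ℝ ((φ : ℝ × ℝ → Vec2) + (ψ : ℝ × ℝ → Vec2)) x = fderiv ℝ (φ : ℝ × ℝ → Vec2) x
      + fderiv ℝ (ψ : ℝ × ℝ → Vec2) x :=
    fderiv_add (φ.2.1.differentiable (by simp) x) (ψ.2.1.differentiable (by simp) x)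
  ext p
  simp [gradField, d]

theorem gradField_smul (c : ℝ) (φ : D.testSpace) :
    gradField ((c • φ : D.testSpace) : ℝ × ℝ → Vec2) =
      c • gradField (φ : ℝ × ℝ → Vec2) := by
  funext x
  have d : fderiv ℝ (c • (φ : ℝ × ℝ → Vec2)) x = c • fderiv ℝ (φ : ℝ × ℝ → Vec2) x :=
    fderiv_const_smul (φ.2.1.differentiable (by simp) x) c
  ext p
  simp [gradField, d]

/-- The inclusion `Ṽ → L²(Ω)²`. -/
def testToL2 : D.testSpace →ₗ[ℝ] D.L2Vec where
  toFun φ := (D.memLp_test φ).toLp _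
  map_add' φ ψ := MemLp.toLp_add (D.memLp_test φ) (D.memLp_test ψ)
  map_smul' c φ := MemLp.toLp_const_smul c (D.memLp_test φ)

/-- The gradient `Ṽ → L²(Ω)^{2×2}`. -/
def testToGrad : D.testSpace →ₗ[ℝ] D.L2Mat where
  toFun φ := (D.memLp_gradField_test φ).toLp _
  map_add' φ ψ := by
    rw [← MemLp.toLp_add (D.memLp_gradField_test φ) (D.memLp_gradField_test ψ)]
    exact MemLp.toLp_congr _ _ (by rw [D.gradField_add])
  map_smul' c φ := by
    rw [RingHom.id_apply, ← MemLp.toLp_const_smul c (D.memLp_gradField_test φ)]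
    exact MemLp.toLp_congr _ _ (by rw [D.gradField_smul])

/-- The inclusion `Ṽ → H¹(Ω)²`, `φ ↦ (φ, ∇φ)`. -/
def testToH1 : D.testSpace →ₗ[ℝ] D.H1Pair :=
  (WithLp.linearEquiv 2 ℝ (D.L2Vec × D.L2Mat)).symm.toLinearMap ∘ₗ
    (D.testToL2.prod D.testToGrad)

/-- The space `H`, the closure of `Ṽ` in `L²(Ω)²`, with the scalar product of `L²(Ω)²`. -/
def H : Submodule ℝ D.L2Vec := (LinearMap.range D.testToL2).topologicalClosure

/-- The space `V`, the closure of `Ṽ` in `H¹(Ω)²`. It carries the `H¹` norm, which is equivalent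
on `V` to the norm `‖v‖ = |∇v|` by Poincaré's inequality. -/
def V : Submodule ℝ D.H1Pair := (LinearMap.range D.testToH1).topologicalClosure

/-- An element of `V` as a square integrable vector field on `Ω`. -/
abbrev vel (u : D.V) : D.L2Vec := (u : D.H1Pair).fst

/-- The gradient of an element of `V`, as a square integrable matrix field on `Ω`. -/
abbrev grad (u : D.V) : D.L2Mat := (u : D.H1Pair).snd

theorem vel_mem (u : D.V) : D.vel u ∈ D.H := by
  have hc : Continuous fun p : D.H1Pair => p.fst := by fun_prop
  refine map_mem_closure (s := (LinearMap.range D.testToH1 : Set D.H1Pair))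
    (t := (LinearMap.range D.testToL2 : Set D.L2Vec)) hc u.2 ?_
  rintro _ ⟨φ, rfl⟩
  exact ⟨φ, rfl⟩

/-- The inclusion `V → H`. -/
def toH (u : D.V) : D.H := ⟨D.vel u, D.vel_mem u⟩

theorem norm_toH_le (u : D.V) : ‖D.toH u‖ ≤ ‖u‖ :=
  WithLp.norm_fst_le (p := 2) (x := (u : D.H1Pair))

/-- The dual space `V'`. -/
abbrev VDual : Type := StrongDual ℝ D.V

/-- The inclusion `H → V'` of the triple `V ⊂ H ⊂ V'`: the functional `Θ ↦ (f, Θ)`. -/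
def toVDual (f : D.H) : D.VDual :=
  LinearMap.mkContinuous
    { toFun := fun Θ => inner ℝ f (D.toH Θ)
      map_add' := fun Θ Ψ => inner_add_right f (D.toH Θ) (D.toH Ψ)
      map_smul' := fun c Θ => real_inner_smul_right f (D.toH Θ) c }
    ‖f‖ fun Θ => (norm_inner_le_norm f (D.toH Θ)).trans
      (mul_le_mul_of_nonneg_left (D.norm_toH_le Θ) (norm_nonneg f))

/-- `V` as the target of the dense inclusion of `Ṽ`. -/
def testToV : D.testSpace →ₗ[ℝ] D.V :=
  D.testToH1.codRestrict D.V fun φ => subset_closure ⟨φ, rfl⟩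

/-- The restriction of an element of `Ṽ` to the bottom `Γ₀`. -/
def testToBottom : D.testSpace →ₗ[ℝ] Lp Vec2 2 (volume.restrict (Ioo 0 D.L)) where
  toFun φ := (D.memLp_bottom_test φ).toLp _
  map_add' φ ψ := MemLp.toLp_add (D.memLp_bottom_test φ) (D.memLp_bottom_test ψ)
  map_smul' c φ := MemLp.toLp_const_smul c (D.memLp_bottom_test φ)

theorem isOpen_dom : IsOpen D.dom := by
  have hc : Continuous D.h := D.h_smooth.continuous
  exact (isOpen_lt continuous_const continuous_fst).inter
    ((isOpen_lt continuous_fst continuous_const).inter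
      ((isOpen_lt continuous_const continuous_snd).inter
        (isOpen_lt continuous_snd (hc.comp continuous_fst))))

theorem norm_vertical_le (φ : ℝ × ℝ → Vec2) (x : ℝ × ℝ) :
    ‖fderiv ℝ φ x (0, 1)‖ ≤ ‖gradField φ x‖ := by
  rw [EuclideanSpace.norm_eq, EuclideanSpace.norm_eq]
  refine Real.sqrt_le_sqrt ?_
  rw [Fintype.sum_prod_type]
  simp only [Fin.sum_univ_two, gradField, coordDir]
  simp only [Matrix.cons_val_zero, Matrix.cons_val_one]
  nlinarith [sq_nonneg ‖fderiv ℝ φ x (1, 0) 0‖, sq_nonneg ‖fderiv ℝ φ x (1, 0) 1‖]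

theorem norm_bottom_le (φ : D.testSpace) (x₁ : ℝ) :
    ‖(φ : ℝ × ℝ → Vec2) (x₁, 0)‖ₑ ^ 2 ≤ ENNReal.ofReal (D.h x₁) *
      ∫⁻ s in Ioo 0 (D.h x₁), ‖gradField (φ : ℝ × ℝ → Vec2) (x₁, s)‖ₑ ^ 2 := by
  obtain ⟨φ, h1, h2, h3, h4, h5⟩ := φ
  have hc := continuous_gradField h1
  have hc' := h1.continuous_fderiv (by simp)
  have hd : ∀ s, HasDerivAt (fun s => φ (x₁, s)) (fderiv ℝ φ (x₁, s) (0, 1)) s := fun s =>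
    ((h1.differentiable (by simp) (x₁, s)).hasFDerivAt).comp_hasDerivAt s
      ((hasDerivAt_const s x₁).prodMk (hasDerivAt_id s))
  have hi := intervalIntegral.integral_eq_sub_of_hasDerivAt (a := 0) (b := D.h x₁)
    (fun s _ => hd s) (Continuous.intervalIntegrable (by fun_prop) _ _)
  rw [h4, zero_sub, intervalIntegral.integral_of_le (D.h_pos x₁).le,
    integral_Ioc_eq_integral_Ioo] at hi
  have e1 : ‖φ (x₁, 0)‖ₑ ≤ ∫⁻ s in Ioo 0 (D.h x₁), ‖gradField φ (x₁, s)‖ₑ := by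
    rw [← enorm_neg, ← hi]
    refine (enorm_integral_le_lintegral_enorm _).trans (lintegral_mono fun s => ?_)
    exact enorm_le_iff_norm_le.2 (norm_vertical_le φ (x₁, s))
  have e2 := ENNReal.lintegral_mul_le_Lp_mul_Lq (volume.restrict (Ioo 0 (D.h x₁)))
    Real.HolderConjugate.two_two (f := fun _ => 1) (g := fun s => ‖gradField φ (x₁, s)‖ₑ)
    aemeasurable_const (by fun_prop)
  simp only [Pi.mul_apply, one_mul] at e2
  have e3 := pow_le_pow_left' (e1.trans e2) 2
  refine e3.trans (le_of_eq ?_)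
  rw [mul_pow, ← ENNReal.rpow_natCast, ← ENNReal.rpow_natCast, ← ENNReal.rpow_mul,
    ← ENNReal.rpow_mul]
  simp

/-- The trace inequality: the restriction to the bottom is bounded by the norm of `V`. -/
theorem trace_bound : ∃ C : ℝ, ∀ φ : D.testSpace, ‖D.testToBottom φ‖ ≤ C * ‖D.testToV φ‖ := by
  obtain ⟨M, hM⟩ := isCompact_Icc.exists_bound_of_continuousOn
    (s := Icc 0 D.L) (f := D.h) D.h_smooth.continuous.continuousOn
  refine ⟨√M, fun φ => ?_⟩
  have hM0 : 0 ≤ M := (norm_nonneg _).trans (hM 0 ⟨le_rfl, D.L_pos.le⟩)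
  have hc := continuous_gradField φ.2.1
  have key : eLpNorm (fun x₁ : ℝ => (φ : ℝ × ℝ → Vec2) (x₁, 0)) 2 (volume.restrict (Ioo 0 D.L)) ^ 2
      ≤ ENNReal.ofReal M * eLpNorm (gradField (φ : ℝ × ℝ → Vec2)) 2 D.mu ^ 2 := by
    have p1 := eLpNorm_nnreal_pow_eq_lintegral (f := fun x₁ : ℝ => (φ : ℝ × ℝ → Vec2) (x₁, 0))
      (μ := volume.restrict (Ioo 0 D.L)) (p := 2) (by norm_num)
    have p2 := eLpNorm_nnreal_pow_eq_lintegral (f := gradField (φ : ℝ × ℝ → Vec2))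
      (μ := D.mu) (p := 2) (by norm_num)
    simp only [NNReal.coe_ofNat, ENNReal.coe_ofNat, ENNReal.rpow_ofNat] at p1 p2
    rw [p1, p2, ← lintegral_indicator D.isOpen_dom.measurableSet, Measure.volume_eq_prod,
      lintegral_prod _ (by
        refine AEMeasurable.indicator ?_ D.isOpen_dom.measurableSet
        fun_prop), ← lintegral_indicator measurableSet_Ioo,
      ← lintegral_const_mul' _ _ ENNReal.ofReal_ne_top]
    refine lintegral_mono fun x₁ => ?_
    by_cases hx : x₁ ∈ Ioo 0 D.L
    · rw [indicator_of_mem hx]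
      refine (D.norm_bottom_le φ x₁).trans ?_
      refine mul_le_mul' (ENNReal.ofReal_le_ofReal
        ((le_abs_self _).trans (hM x₁ ⟨hx.1.le, hx.2.le⟩))) ?_
      rw [← lintegral_indicator measurableSet_Ioo]
      refine lintegral_mono fun s => ?_
      by_cases hs : s ∈ Ioo 0 (D.h x₁)
      · rw [indicator_of_mem hs, indicator_of_mem (show (x₁, s) ∈ D.dom from
          ⟨hx.1, hx.2, hs.1, hs.2⟩)]
      · simp [indicator_of_notMem hs]
    · simp [indicator_of_notMem hx]
  have h1 : ‖D.testToBottom φ‖ ^ 2 ≤ M * ‖D.testToGrad φ‖ ^ 2 := by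
    have := ENNReal.toReal_mono (ENNReal.mul_ne_top ENNReal.ofReal_ne_top
      (ENNReal.pow_ne_top (D.memLp_gradField_test φ).2.ne)) key
    rw [ENNReal.toReal_mul, ENNReal.toReal_pow, ENNReal.toReal_pow,
      ENNReal.toReal_ofReal hM0] at this
    simpa only [testToBottom, testToGrad, LinearMap.coe_mk, AddHom.coe_mk, Lp.norm_toLp] using this
  have h2 : ‖D.testToGrad φ‖ ≤ ‖D.testToV φ‖ :=
    WithLp.norm_snd_le (p := 2) (x := D.testToH1 φ)
  refine abs_le_of_sq_le_sq' ?_ (by positivity) |>.2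
  rw [mul_pow, Real.sq_sqrt hM0]
  exact h1.trans (by gcongr)

theorem denseRange_testToV : DenseRange D.testToV := by
  intro u
  rw [closure_subtype]
  refine closure_mono ?_ u.2
  rintro _ ⟨φ, rfl⟩
  exact ⟨D.testToV φ, ⟨φ, rfl⟩, rfl⟩

/-- The trace `V → L²(Γ₀)²`: the continuous extension of the restriction `Ṽ → L²(Γ₀)²`. -/
def trace : D.V →L[ℝ] Lp Vec2 2 (volume.restrict (Ioo 0 D.L)) :=
  D.testToBottom.extendOfNorm D.testToV

/-- On `Ṽ` the trace is the restriction to `Γ₀`. -/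
theorem trace_testToV (φ : D.testSpace) : D.trace (D.testToV φ) = D.testToBottom φ :=
  LinearMap.extendOfNorm_eq D.denseRange_testToV D.trace_bound φ

/-- The functional `j(u) = ∫_{Γ₀} k |u(x₁, 0)| dx₁`. -/
def j (k : ℝ) (u : D.V) : ℝ := ∫ x₁ in Ioo 0 D.L, k * ‖D.trace u x₁‖

/-- `(G₁, G₂)` for matrix fields on `Ω`; with gradients it is `a(u, v) = (∇u, ∇v)`. -/
def aForm (G₁ G₂ : ℝ × ℝ → Mat2) : ℝ := ∫ x in D.dom, inner ℝ (G₁ x) (G₂ x)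

/-- `∫_Ω ∑ᵢⱼ uⱼ Gᵢⱼ wᵢ`; with `G = ∇v` it is `b(u, v, w) = ((u · ∇) v, w)`. -/
def bForm (u : ℝ × ℝ → Vec2) (G : ℝ × ℝ → Mat2) (w : ℝ × ℝ → Vec2) : ℝ :=
  ∫ x in D.dom, ∑ i, ∑ j, u x j * G x (i, j) * w x i

/-- The background flow `ξ = U(x₂) e₁`. -/
def background (U : ℝ → ℝ) (x : ℝ × ℝ) : Vec2 := WithLp.toLp 2 ![U x.2, 0]

/-- `U(x₂) e₁` is a smooth extension to `Ω` of the boundary velocity `U₀ e₁`. -/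
structure IsBackground (U₀ : ℝ) (U : ℝ → ℝ) : Prop where
  smooth : ContDiff ℝ ∞ U
  bottom : U 0 = U₀
  top : ∀ x₁ ∈ Ioo 0 D.L, U (D.h x₁) = 0
  deriv_bottom : deriv U 0 = 0

/-- `(𝓛(v), Θ) = - ν a(ξ, Θ) - b(ξ, v, Θ) - b(v, ξ, Θ)` with `ξ = U e₁`. -/
def forcing (ν : ℝ) (U : ℝ → ℝ) (v Θ : D.V) : ℝ :=
  - ν * D.aForm (gradField (background U)) (D.grad Θ)
    - D.bForm (background U) (D.grad v) (D.vel Θ)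
    - D.bForm (D.vel v) (gradField (background U)) (D.vel Θ)

/-- `g` is the derivative of `v` on `(0, T)` in the sense of distributions with values in `V'`. -/
def IsWeakTimeDeriv (T : ℝ) (v : ℝ → D.H) (g : ℝ → D.VDual) : Prop :=
  ∀ ψ : ℝ → ℝ, ContDiff ℝ ∞ ψ → HasCompactSupport ψ → tsupport ψ ⊆ Ioo 0 T →
    ∫ t in Ioo 0 T, deriv ψ t • D.toVDual (v t) = - ∫ t in Ioo 0 T, ψ t • g t

/-- `v : [0, ∞) → H` (its values at negative times are irrelevant) solves the variational
inequality with initial value `v₀`. Here `vV` is `v` as an element of `L²(0, T; V)` and `vt` is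
its time derivative in `L²(0, T; V')`, for every `T > 0`. -/
def IsSolution (ν k : ℝ) (U : ℝ → ℝ) (v₀ : D.H) (v : ℝ → D.H) : Prop :=
  ∃ (vV : ℝ → D.V) (vt : ℝ → D.VDual),
    (∀ T > 0, ContinuousOn v (Icc 0 T) ∧
      MemLp vV 2 (volume.restrict (Ioo 0 T)) ∧
      (∀ᵐ t ∂(volume.restrict (Ioo 0 T)), D.toH (vV t) = v t) ∧
      MemLp vt 2 (volume.restrict (Ioo 0 T)) ∧
      D.IsWeakTimeDeriv T v vt) ∧
    (∀ (Θ : D.V), ∀ T > 0, ∀ᵐ t ∂(volume.restrict (Ioo 0 T)),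
      vt t (Θ - vV t) + ν * D.aForm (D.grad (vV t)) (D.grad (Θ - vV t))
          + D.bForm (D.vel (vV t)) (D.grad (vV t)) (D.vel (Θ - vV t))
          + D.j k Θ - D.j k (vV t)
        ≥ D.forcing ν U (vV t) (Θ - vV t)) ∧
    v 0 = v₀

end PeriodicChannel

end

open MeasureTheory Set
open scoped ContDiff

noncomputable section

/-! ### Integration over the channel and skew symmetry of convection on smooth fields -/

namespace PeriodicChannel

variable (D : PeriodicChannel)

/-! The theorem is the two-dimensional Navier–Stokes uniqueness argument, in which the friction
functional `j` drops out. Test the inequality for `v` with `w(t)` and the one for `w` with `v(t)`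
and add: the values of `j` cancel. With `z = w - v`, bilinearity and `b(u, z, z) = 0` leave `⟨z_t,
z⟩ ≤ -ν |∇z|² - b(z, v, z) - b(z, ξ, z)`. In two dimensions `|b(z, v, z)| ≤ C |z| ‖z‖ ‖v‖`, so
Young's inequality absorbs `‖z‖²` into the viscosity and leaves `⟨z_t, z⟩ ≤ A (1 + ‖v‖²) |z|²`.
Gronwall's inequality then gives a Lipschitz constant depending only on `T` and `∫₀ᵀ ‖v‖²`. Testing
with `Θ = 0`, where `j ≥ 0` has the right sign, bounds that integral in terms of `|v(0)|`.
Uniqueness is the case `τ = 0` with equal initial values.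

Three analytic facts carry this. Ladyzhenskaya's inequality `ladyzhenskaya`, proved on `Ṽ` in
flattened coordinates and extended by density, gives the bound on `b` (`abs_bV_le`). The identity
`bV_self` comes from the divergence theorem on `Ṽ`, again by density. The energy identity
`norm_sq_sub_norm_sq_eq` gives a meaning to `2⟨z_t, z⟩ = d/dt |z|²` when `z_t` lies only in `L²(0,
T; V')`.

The inequality holds for each fixed `Θ` outside a null set of times that may depend on `Θ`, whereas
the argument needs the time-dependent `Θ = w(t)`. Separability of `V` and continuity in `Θ` provide
a common null set (`IsSolution.exists_solutionOn`). The background flow itself lies in `Ṽ`, so its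
terms obey the same estimates. -/

theorem integrableOn_dom_of_continuous {F : Type*} [NormedAddCommGroup F] {f : ℝ × ℝ → F}
    (hf : Continuous f) : IntegrableOn f D.dom := by
  obtain ⟨K, hK, hs⟩ := D.dom_bounded
  exact (hf.continuousOn.integrableOn_compact hK).mono_set hs

/-- Integration over the channel in the flattened coordinates `(x, s) ↦ (x, h(x) s)`. -/
theorem integral_dom {f : ℝ × ℝ → ℝ} (hf : Continuous f) :
    ∫ x in D.dom, f x = ∫ x in (0 : ℝ)..D.L, ∫ s in (0 : ℝ)..1, D.h x * f (x, D.h x * s) := by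
  have hi : Integrable (D.dom.indicator f) (volume.prod volume) :=
    (integrable_indicator_iff D.isOpen_dom.measurableSet).2 (D.integrableOn_dom_of_continuous hf)
  rw [← integral_indicator D.isOpen_dom.measurableSet, Measure.volume_eq_prod,
    integral_prod _ hi, intervalIntegral.integral_of_le D.L_pos.le,
    integral_Ioc_eq_integral_Ioo, ← integral_indicator measurableSet_Ioo]
  congr 1
  funext x
  by_cases hx : x ∈ Ioo 0 D.L
  · rw [indicator_of_mem hx, intervalIntegral.integral_const_mul,
      intervalIntegral.mul_integral_comp_mul_left (f := fun y => f (x, y)), mul_zero, mul_one,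
      intervalIntegral.integral_of_le (D.h_pos x).le, integral_Ioc_eq_integral_Ioo,
      ← integral_indicator measurableSet_Ioo]
    congr 1
    funext y
    have : (x, y) ∈ D.dom ↔ y ∈ Ioo 0 (D.h x) :=
      ⟨fun h => ⟨h.2.2.1, h.2.2.2⟩, fun h => ⟨hx.1, hx.2, h.1, h.2⟩⟩
    by_cases hy : y ∈ Ioo 0 (D.h x)
    · rw [indicator_of_mem hy, indicator_of_mem (this.2 hy)]
    · rw [indicator_of_notMem hy, indicator_of_notMem fun h => hy (this.1 h)]
  · have : ∀ y, (x, y) ∉ D.dom := fun y h => hx ⟨h.1, h.2.1⟩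
    simp [this, hx]

theorem hasDerivAt_h (x : ℝ) : HasDerivAt D.h (deriv D.h x) x :=
  (D.h_smooth.differentiable (by simp) x).hasDerivAt

theorem continuous_deriv_h : Continuous (deriv D.h) :=
  D.h_smooth.continuous_deriv (by simp)

@[fun_prop]
theorem continuous_h : Continuous D.h := D.h_smooth.continuous

/-- The derivative along a horizontal line of the flattened domain. -/
theorem hasDerivAt_flatten_fst {F : Type*} [NormedAddCommGroup F] [NormedSpace ℝ F]
    {f : ℝ × ℝ → F} (hf : Differentiable ℝ f) (x s : ℝ) :
    HasDerivAt (fun r => f (r, D.h r * s))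
      (fderiv ℝ f (x, D.h x * s) (1, 0) +
        (deriv D.h x * s) • fderiv ℝ f (x, D.h x * s) (0, 1)) x := by
  have h1 : HasDerivAt (fun r => (r, D.h r * s)) ((1 : ℝ), deriv D.h x * s) x :=
    (hasDerivAt_id x).prodMk ((D.hasDerivAt_h x).mul_const s)
  have h2 := (hf (x, D.h x * s)).hasFDerivAt.comp_hasDerivAt x h1
  refine HasDerivAt.congr_deriv h2 ?_
  rw [← map_smul, ← map_add]
  simp

/-- The derivative along a vertical line of the flattened domain. -/
theorem hasDerivAt_flatten_snd {F : Type*} [NormedAddCommGroup F] [NormedSpace ℝ F]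
    {f : ℝ × ℝ → F} (hf : Differentiable ℝ f) (x s : ℝ) :
    HasDerivAt (fun r => f (x, D.h x * r)) (D.h x • fderiv ℝ f (x, D.h x * s) (0, 1)) s := by
  have h1 : HasDerivAt (fun r => (x, D.h x * r)) ((0 : ℝ), D.h x * 1) s :=
    (hasDerivAt_const s x).prodMk ((hasDerivAt_id s).const_mul _)
  have h2 := (hf (x, D.h x * s)).hasFDerivAt.comp_hasDerivAt s h1
  refine HasDerivAt.congr_deriv h2 ?_
  rw [← map_smul]
  simp

/-- The divergence theorem in the channel, for a periodic field that vanishes on the top and is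
tangential on the bottom. -/
theorem integral_div_eq_zero {p q : ℝ × ℝ → ℝ} (hp : ContDiff ℝ 1 p) (hq : ContDiff ℝ 1 q)
    (hper : ∀ y, p (D.L, y) = p (0, y)) (hp1 : ∀ x, p (x, D.h x) = 0)
    (hq1 : ∀ x, q (x, D.h x) = 0) (hq0 : ∀ x, q (x, 0) = 0) :
    ∫ x in D.dom, (fderiv ℝ p x (1, 0) + fderiv ℝ q x (0, 1)) = 0 := by
  have hp' := hp.continuous_fderiv (by simp)
  have hq' := hq.continuous_fderiv (by simp)
  have hh : ContDiff ℝ 1 D.h := D.h_smooth.of_le (by simp)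
  have hdh : ContDiff ℝ 1 (deriv D.h) :=
    ((contDiff_infty_iff_deriv.1 D.h_smooth).2).of_le (by simp)
  rw [D.integral_dom (by fun_prop)]
  -- `(P, Q)` is the Piola transform of `(p, q)` under `(x, s) ↦ (x, h(x) s)`: its divergence on the
  -- rectangle is `h` times the divergence of `(p, q)`, which is the integrand to be evaluated.
  set P : ℝ × ℝ → ℝ := fun z => D.h z.1 * p (z.1, D.h z.1 * z.2) with hP
  set Q : ℝ × ℝ → ℝ := fun z =>
    q (z.1, D.h z.1 * z.2) - z.2 * deriv D.h z.1 * p (z.1, D.h z.1 * z.2) with hQ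
  have cP : ContDiff ℝ 1 P := by fun_prop
  have cQ : ContDiff ℝ 1 Q := by fun_prop
  have hP' := cP.continuous_fderiv (by simp)
  have hQ' := cQ.continuous_fderiv (by simp)
  have key := integral2_divergence_prod_of_hasFDerivAt P Q (fderiv ℝ P) (fderiv ℝ Q) 0 0 D.L 1
    cP.continuous.continuousOn cQ.continuous.continuousOn
    (fun x _ => (cP.differentiable (by simp) x).hasFDerivAt)
    (fun x _ => (cQ.differentiable (by simp) x).hasFDerivAt)
    (Continuous.continuousOn (by fun_prop) |>.integrableOn_compact
      (isCompact_uIcc.prod isCompact_uIcc))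
  have hL : D.h D.L = D.h 0 := by simpa using D.h_periodic 0
  have e : ∀ x s, fderiv ℝ P (x, s) (1, 0) + fderiv ℝ Q (x, s) (0, 1) =
      D.h x * (fderiv ℝ p (x, D.h x * s) (1, 0) + fderiv ℝ q (x, D.h x * s) (0, 1)) := by
    intro x s
    have a1 : HasDerivAt (fun r => P (r, s)) (fderiv ℝ P (x, s) (1, 0)) x :=
      (cP.differentiable (by simp) (x, s)).hasFDerivAt.comp_hasDerivAt (f := fun r => (r, s)) x
        ((hasDerivAt_id x).prodMk (hasDerivAt_const x s))
    have a2 : HasDerivAt (fun r => Q (x, r)) (fderiv ℝ Q (x, s) (0, 1)) s :=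
      (cQ.differentiable (by simp) (x, s)).hasFDerivAt.comp_hasDerivAt (f := fun r => (x, r)) s
        ((hasDerivAt_const s x).prodMk (hasDerivAt_id s))
    have b1 := (D.hasDerivAt_h x).mul
      (D.hasDerivAt_flatten_fst (hp.differentiable (by simp)) x s)
    have b2 := (D.hasDerivAt_flatten_snd (hq.differentiable (by simp)) x s).sub
      (((hasDerivAt_id s).mul_const (deriv D.h x)).mul
        (D.hasDerivAt_flatten_snd (hp.differentiable (by simp)) x s))
    rw [a1.unique b1, a2.unique b2]
    simp only [smul_eq_mul, id]
    ring
  simp only [e] at key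
  rw [key]
  -- The two vertical sides cancel by periodicity. On `s = 1` both `p` and `q` vanish; on `s = 0`
  -- the term with `deriv h` carries the factor `s`, and `q` vanishes.
  simp [hP, hQ, hp1, hq1, hq0, hper, hL]

theorem gradField_zero_apply (φ : ℝ × ℝ → Vec2) (x : ℝ × ℝ) (i : Fin 2) :
    gradField φ x (i, 0) = fderiv ℝ φ x (1, 0) i := rfl

theorem gradField_one_apply (φ : ℝ × ℝ → Vec2) (x : ℝ × ℝ) (i : Fin 2) :
    gradField φ x (i, 1) = fderiv ℝ φ x (0, 1) i := rfl

/-- `b(φ, ψ, ψ) = 0` for smooth fields. -/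
theorem bForm_test_self (φ ψ : D.testSpace) :
    bForm D φ (gradField ψ) ψ = 0 := by
  obtain ⟨φ, f1, f2, f3, f4, f5⟩ := φ
  obtain ⟨ψ, g1, g2, g3, g4, g5⟩ := ψ
  have f1' : ContDiff ℝ 1 φ := f1.of_le (by simp)
  have g1' : ContDiff ℝ 1 ψ := g1.of_le (by simp)
  -- Since `div φ = 0`, the integrand `(φ · ∇)ψ · ψ` equals `div (φ |ψ|² / 2)`. The flux through the
  -- bottom vanishes because `φ` is tangential there, whatever `ψ` does.
  have key := D.integral_div_eq_zero (p := fun x => φ x 0 * (ψ x 0 ^ 2 + ψ x 1 ^ 2) * (1 / 2))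
    (q := fun x => φ x 1 * (ψ x 0 ^ 2 + ψ x 1 ^ 2) * (1 / 2)) (by fun_prop) (by fun_prop)
    (fun y => by
      have := f2 0 y
      have := g2 0 y
      simp_all) (fun x => by simp [f4]) (fun x => by simp [f4]) (fun x => by simp [f5])
  refine Eq.trans ?_ key
  refine setIntegral_congr_fun D.isOpen_dom.measurableSet fun x hx => ?_
  have hφ : ∀ i, HasFDerivAt (fun x => φ x i) (EuclideanSpace.proj i ∘L fderiv ℝ φ x) x := fun i =>
    (EuclideanSpace.proj (𝕜 := ℝ) i).hasFDerivAt.comp x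
      (f1.differentiable (by simp) x).hasFDerivAt
  have hψ : ∀ i, HasFDerivAt (fun x => ψ x i) (EuclideanSpace.proj i ∘L fderiv ℝ ψ x) x := fun i =>
    (EuclideanSpace.proj (𝕜 := ℝ) i).hasFDerivAt.comp x
      (g1.differentiable (by simp) x).hasFDerivAt
  have hdiv := f3 x ⟨hx.2.2.1, hx.2.2.2⟩
  have e : ∀ i, fderiv ℝ (fun x => φ x i * (ψ x 0 ^ 2 + ψ x 1 ^ 2) * (1 / 2)) x = _ := fun i =>
    (((hφ i).mul (((hψ 0).pow 2).add ((hψ 1).pow 2))).mul_const (1 / 2)).fderiv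
  rw [e 0, e 1]
  simp only [Fin.sum_univ_two, gradField_zero_apply, gradField_one_apply] at hdiv ⊢
  simp
  linear_combination (-(ψ x 0 ^ 2 + ψ x 1 ^ 2) / 2) * hdiv

end PeriodicChannel

/-! ### Ladyzhenskaya's inequality -/

/-- A one-dimensional Agmon inequality on an interval. -/
theorem norm_sq_le_norm_sq_add_integral {F : Type*} [NormedAddCommGroup F]
    [InnerProductSpace ℝ F] {f f' : ℝ → F} {g : ℝ → ℝ} (hf : ∀ t, HasDerivAt f (f' t) t)
    (hf' : Continuous f') (hg : Continuous g) {a b : ℝ}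
    (hfg : ∀ t ∈ Icc a b, ‖f t‖ * ‖f' t‖ ≤ g t) {s t : ℝ} (hs : s ∈ Icc a b) (ht : t ∈ Icc a b) :
    ‖f t‖ ^ 2 ≤ ‖f s‖ ^ 2 + 2 * ∫ r in a..b, g r := by
  have hc : Continuous f := continuous_iff_continuousAt.2 fun t => (hf t).continuousAt
  have hi := intervalIntegral.integral_eq_sub_of_hasDerivAt (a := s) (b := t)
    (fun r _ => (hf r).norm_sq) (Continuous.intervalIntegrable (by fun_prop) _ _)
  have hab : a ≤ b := hs.1.trans hs.2
  have hsub : uIoc s t ⊆ Icc a b := uIoc_subset_uIcc.trans (uIcc_subset_Icc hs ht)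
  have h1 : |∫ r in s..t, 2 * inner ℝ (f r) (f' r)| ≤ |∫ r in s..t, 2 * g r| := by
    refine intervalIntegral.norm_integral_le_abs_of_norm_le
      (f := fun r => 2 * inner ℝ (f r) (f' r)) ?_
      (Continuous.intervalIntegrable (by fun_prop) _ _)
    refine (ae_restrict_mem measurableSet_uIoc).mono fun r hr => ?_
    rw [norm_mul, Real.norm_two]
    exact mul_le_mul_of_nonneg_left ((norm_inner_le_norm _ _).trans (hfg r (hsub hr))) zero_le_two
  -- The bound `g` is nonnegative on `[a, b]`, so the integral can be enlarged to the whole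
  -- interval, making the estimate independent of `s` and `t`.
  have h2 : |∫ r in s..t, 2 * g r| ≤ |∫ r in a..b, 2 * g r| := by
    refine intervalIntegral.abs_integral_mono_interval ?_ ?_
      (Continuous.intervalIntegrable (by fun_prop) _ _)
    · rw [uIoc_of_le hab]
      refine Ioc_subset_Ioc (le_min hs.1 ht.1) (max_le hs.2 ht.2)
    · refine (ae_restrict_mem measurableSet_uIoc).mono fun r hr => ?_
      rw [uIoc_of_le hab] at hr
      have := (mul_nonneg (norm_nonneg _) (norm_nonneg _)).trans (hfg r ⟨hr.1.le, hr.2⟩)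
      simpa using this
  have h3 : 0 ≤ ∫ r in a..b, 2 * g r := intervalIntegral.integral_nonneg hab fun r hr => by
    have := (mul_nonneg (norm_nonneg _) (norm_nonneg _)).trans (hfg r hr)
    linarith
  rw [abs_of_nonneg h3] at h2
  have := (le_abs_self _).trans (h1.trans h2)
  rw [hi, intervalIntegral.integral_const_mul] at this
  linarith

namespace PeriodicChannel

variable (D : PeriodicChannel)

theorem norm_horizontal_le (φ : ℝ × ℝ → Vec2) (x : ℝ × ℝ) :
    ‖fderiv ℝ φ x (1, 0)‖ ≤ ‖gradField φ x‖ := by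
  rw [EuclideanSpace.norm_eq, EuclideanSpace.norm_eq]
  refine Real.sqrt_le_sqrt ?_
  rw [Fintype.sum_prod_type]
  simp only [Fin.sum_univ_two, gradField, coordDir]
  simp only [Matrix.cons_val_zero, Matrix.cons_val_one]
  nlinarith [sq_nonneg ‖fderiv ℝ φ x (0, 1) 0‖, sq_nonneg ‖fderiv ℝ φ x (0, 1) 1‖]

theorem exists_bounds : ∃ m M K : ℝ, 0 < m ∧ 0 < M ∧ 0 < K ∧
    ∀ x ∈ Icc 0 D.L, m ≤ D.h x ∧ D.h x ≤ M ∧ 1 + |deriv D.h x| ≤ K := by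
  obtain ⟨M, hM⟩ := isCompact_Icc.exists_bound_of_continuousOn
    (s := Icc 0 D.L) (f := D.h) D.continuous_h.continuousOn
  obtain ⟨K, hK⟩ := isCompact_Icc.exists_bound_of_continuousOn
    (s := Icc 0 D.L) (f := deriv D.h) D.continuous_deriv_h.continuousOn
  obtain ⟨x₀, -, hm⟩ := isCompact_Icc.exists_isMinOn (nonempty_Icc.2 D.L_pos.le)
    D.continuous_h.continuousOn
  have h0 : (0 : ℝ) ∈ Icc 0 D.L := ⟨le_rfl, D.L_pos.le⟩
  refine ⟨D.h x₀, M, 1 + K, D.h_pos _, ?_, ?_, fun x hx => ⟨hm hx, ?_, ?_⟩⟩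
  · exact (D.h_pos 0).trans_le ((le_abs_self _).trans (hM 0 h0))
  · have := (norm_nonneg _).trans (hK 0 h0)
    linarith
  · exact (le_abs_self _).trans (hM x hx)
  · have := hK x hx
    rw [Real.norm_eq_abs] at this
    linarith

section Ladyzhenskaya

variable (φ : D.testSpace)

/-- The product `|φ| |∇φ|`. -/
def prodGrad (x : ℝ × ℝ) : ℝ := ‖(φ : ℝ × ℝ → Vec2) x‖ * ‖gradField (φ : ℝ × ℝ → Vec2) x‖

theorem continuous_test : Continuous (φ : ℝ × ℝ → Vec2) := φ.2.1.continuous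

theorem continuous_prodGrad : Continuous (D.prodGrad φ) :=
  (D.continuous_test φ).norm.mul (continuous_gradField φ.2.1).norm

theorem prodGrad_nonneg (x : ℝ × ℝ) : 0 ≤ D.prodGrad φ x := by
  unfold prodGrad; positivity

/-- The field vanishes at `s = 1`, the top of the channel, so the one-dimensional inequality started
there has no boundary term. The right side does not depend on `s`. -/
theorem norm_sq_le_vertical (x : ℝ) {s : ℝ} (hs : s ∈ Icc (0 : ℝ) 1) :
    ‖(φ : ℝ × ℝ → Vec2) (x, D.h x * s)‖ ^ 2 ≤
      2 * ∫ r in (0 : ℝ)..1, D.h x * D.prodGrad φ (x, D.h x * r) := by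
  have hc := continuous_prodGrad D φ
  have hc' := φ.2.1.continuous_fderiv (by simp)
  have key := norm_sq_le_norm_sq_add_integral
    (f := fun s => (φ : ℝ × ℝ → Vec2) (x, D.h x * s))
    (g := fun r => D.h x * D.prodGrad φ (x, D.h x * r)) (a := 0) (b := 1)
    (fun t => D.hasDerivAt_flatten_snd (φ.2.1.differentiable (by simp)) x t)
    (by fun_prop) (by fun_prop) (fun t _ => by
      rw [norm_smul, Real.norm_of_nonneg (D.h_pos x).le, prodGrad]
      have := norm_vertical_le φ (x, D.h x * t)
      have := D.h_pos x
      rw [mul_left_comm]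
      gcongr) (s := 1) (t := s) (by simp) hs
  simpa [φ.2.2.2.2.1] using key

/-- Along the curve `s = const` the field need not vanish anywhere, so the starting point `y` is
averaged over a period; this produces the term with `D.L⁻¹`. The derivative along the curve is `∂₁φ
+ h' s ∂₂φ`, hence the factor `K ≥ 1 + |h'|`. The right side does not depend on `x`. -/
theorem norm_sq_le_horizontal {K : ℝ} (hK : ∀ x ∈ Icc 0 D.L, 1 + |deriv D.h x| ≤ K) {s : ℝ}
    (hs : s ∈ Icc (0 : ℝ) 1) {x : ℝ} (hx : x ∈ Icc 0 D.L) :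
    ‖(φ : ℝ × ℝ → Vec2) (x, D.h x * s)‖ ^ 2 ≤
      ∫ y in (0 : ℝ)..D.L, (D.L⁻¹ * ‖(φ : ℝ × ℝ → Vec2) (y, D.h y * s)‖ ^ 2 +
        2 * K * D.prodGrad φ (y, D.h y * s)) := by
  have hc := continuous_prodGrad D φ
  have hc0 := continuous_test D φ
  have hc' := φ.2.1.continuous_fderiv (by simp)
  have hdh := D.continuous_deriv_h
  have key : ∀ y ∈ Icc 0 D.L, ‖(φ : ℝ × ℝ → Vec2) (x, D.h x * s)‖ ^ 2 ≤
      ‖(φ : ℝ × ℝ → Vec2) (y, D.h y * s)‖ ^ 2 +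
        2 * ∫ r in (0 : ℝ)..D.L, K * D.prodGrad φ (r, D.h r * s) := fun y hy =>
    norm_sq_le_norm_sq_add_integral
      (f := fun r => (φ : ℝ × ℝ → Vec2) (r, D.h r * s))
      (fun t => D.hasDerivAt_flatten_fst (φ.2.1.differentiable (by simp)) t s)
      (by fun_prop) (by fun_prop) (fun t ht => by
        rw [prodGrad, mul_left_comm]
        refine mul_le_mul_of_nonneg_left ?_ (norm_nonneg _)
        refine (norm_add_le _ _).trans ?_
        rw [norm_smul, norm_mul, Real.norm_eq_abs, Real.norm_eq_abs, abs_of_nonneg hs.1]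
        have h1 := norm_vertical_le φ (t, D.h t * s)
        have h2 := norm_horizontal_le φ (t, D.h t * s)
        have h3 : |deriv D.h t| * s * ‖fderiv ℝ (φ : ℝ × ℝ → Vec2) (t, D.h t * s) (0, 1)‖ ≤
            |deriv D.h t| * 1 * ‖gradField (φ : ℝ × ℝ → Vec2) (t, D.h t * s)‖ := by
          have := hs.2
          gcongr
        have h4 := mul_le_mul_of_nonneg_right (hK t ht)
          (norm_nonneg (gradField (φ : ℝ × ℝ → Vec2) (t, D.h t * s)))
        linarith) hy hx
  have hint := intervalIntegral.integral_mono_on (μ := volume) D.L_pos.le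
    (Continuous.intervalIntegrable (by fun_prop) _ _)
    (Continuous.intervalIntegrable (by fun_prop) _ _) key
  have hL := D.L_pos
  rw [intervalIntegral.integral_add (Continuous.intervalIntegrable (by fun_prop) _ _)
    (Continuous.intervalIntegrable (by fun_prop) _ _)] at hint ⊢
  simp only [intervalIntegral.integral_const, sub_zero, smul_eq_mul,
    intervalIntegral.integral_const_mul] at hint ⊢
  have := mul_le_mul_of_nonneg_left hint (inv_nonneg.2 hL.le)
  rw [inv_mul_cancel_left₀ hL.ne'] at this
  refine this.trans (le_of_eq ?_)
  field_simp
  simp only [mul_comm s]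

theorem integral_norm_sq_test :
    ∫ x in D.dom, ‖(φ : ℝ × ℝ → Vec2) x‖ ^ 2 = ‖D.testToL2 φ‖ ^ 2 := by
  rw [← real_inner_self_eq_norm_sq, L2.inner_def]
  refine integral_congr_ae ?_
  filter_upwards [(D.memLp_test φ).coeFn_toLp] with x hx
  rw [← real_inner_self_eq_norm_sq]
  simp only [testToL2, LinearMap.coe_mk, AddHom.coe_mk, hx]

theorem integral_norm_sq_grad :
    ∫ x in D.dom, ‖gradField (φ : ℝ × ℝ → Vec2) x‖ ^ 2 = ‖D.testToGrad φ‖ ^ 2 := by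
  rw [← real_inner_self_eq_norm_sq, L2.inner_def]
  refine integral_congr_ae ?_
  filter_upwards [(D.memLp_gradField_test φ).coeFn_toLp] with x hx
  rw [← real_inner_self_eq_norm_sq]
  simp only [testToGrad, LinearMap.coe_mk, AddHom.coe_mk, hx]

theorem integral_prodGrad_le :
    ∫ x in D.dom, D.prodGrad φ x ≤ ‖D.testToL2 φ‖ * ‖D.testToGrad φ‖ := by
  have := integral_mul_le_Lp_mul_Lq_of_nonneg (μ := D.mu) Real.HolderConjugate.two_two
    (f := fun x => ‖(φ : ℝ × ℝ → Vec2) x‖) (g := fun x => ‖gradField (φ : ℝ × ℝ → Vec2) x‖)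
    (ae_of_all _ fun _ => norm_nonneg _) (ae_of_all _ fun _ => norm_nonneg _)
    (by simpa using (D.memLp_test φ).norm) (by simpa using (D.memLp_gradField_test φ).norm)
  simp only [Real.rpow_two, integral_norm_sq_test, integral_norm_sq_grad] at this
  rwa [← Real.sqrt_eq_rpow, ← Real.sqrt_eq_rpow, Real.sqrt_sq (norm_nonneg _),
    Real.sqrt_sq (norm_nonneg _)] at this

/-- Ladyzhenskaya's inequality on `Ṽ`. -/
theorem ladyzhenskaya_test : ∃ C : ℝ, 0 ≤ C ∧ ∀ φ : D.testSpace,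
    ∫ x in D.dom, ‖(φ : ℝ × ℝ → Vec2) x‖ ^ 4 ≤ C * (‖D.testToL2 φ‖ * ‖D.testToV φ‖) ^ 2 := by
  obtain ⟨m, M, K, hm, hM, hK, hb⟩ := D.exists_bounds
  have hL := D.L_pos
  -- `M` bounds the Jacobian `h`, the factor `2` comes from `∫ A`, and the bracket from `∫ B`.
  refine ⟨M * 2 * (m⁻¹ * (D.L⁻¹ + 2 * K)), by positivity, fun φ => ?_⟩
  have hc := continuous_prodGrad D φ
  have hc0 := continuous_test D φ
  set A : ℝ → ℝ := fun x => 2 * ∫ r in (0 : ℝ)..1, D.h x * D.prodGrad φ (x, D.h x * r) with hA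
  set f : ℝ × ℝ → ℝ := fun x => D.L⁻¹ * ‖(φ : ℝ × ℝ → Vec2) x‖ ^ 2 + 2 * K * D.prodGrad φ x
    with hf
  have hf0 : ∀ x, 0 ≤ f x := fun x => by
    have := D.prodGrad_nonneg φ x
    positivity
  have hfc : Continuous f := by fun_prop
  set B : ℝ → ℝ := fun s => ∫ y in (0 : ℝ)..D.L, f (y, D.h y * s) with hB
  have cA : Continuous A := by
    refine continuous_const.mul ?_
    exact intervalIntegral.continuous_parametric_intervalIntegral_of_continuous' (by fun_prop) _ _
  have cB : Continuous B :=
    intervalIntegral.continuous_parametric_intervalIntegral_of_continuous' (by fun_prop) _ _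
  have hV0 : ‖D.testToL2 φ‖ ≤ ‖D.testToV φ‖ := WithLp.norm_fst_le (p := 2) (x := D.testToH1 φ)
  have hV1 : ‖D.testToGrad φ‖ ≤ ‖D.testToV φ‖ := WithLp.norm_snd_le (p := 2) (x := D.testToH1 φ)
  -- One factor `|φ|²` is bounded by a function of `x` alone, the other by a function of `s` alone,
  -- so the double integral of the product splits.
  have h1 : ∫ x in D.dom, ‖(φ : ℝ × ℝ → Vec2) x‖ ^ 4 ≤
      ∫ x in (0 : ℝ)..D.L, ∫ s in (0 : ℝ)..1, M * (A x * B s) := by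
    rw [D.integral_dom (by fun_prop)]
    refine intervalIntegral.integral_mono_on hL.le
      (Continuous.intervalIntegrable
        (intervalIntegral.continuous_parametric_intervalIntegral_of_continuous'
          (by fun_prop) _ _) _ _)
      (Continuous.intervalIntegrable
        (intervalIntegral.continuous_parametric_intervalIntegral_of_continuous'
          (by fun_prop) _ _) _ _) fun x hx => ?_
    refine intervalIntegral.integral_mono_on zero_le_one
      (Continuous.intervalIntegrable (by fun_prop) _ _)
      (Continuous.intervalIntegrable (by fun_prop) _ _) fun s hs => ?_
    have e1 := D.norm_sq_le_vertical φ x hs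
    have e2 := D.norm_sq_le_horizontal φ (fun y hy => (hb y hy).2.2) hs hx
    have e3 := mul_le_mul e1 e2 (by positivity) ((sq_nonneg _).trans e1)
    rw [show (4 : ℕ) = 2 + 2 from rfl, pow_add]
    exact mul_le_mul (hb x hx).2.1 e3 (by positivity) hM.le
  have h2 : ∫ x in (0 : ℝ)..D.L, A x ≤ 2 * (‖D.testToL2 φ‖ * ‖D.testToV φ‖) := by
    rw [intervalIntegral.integral_const_mul, ← D.integral_dom hc]
    have := D.integral_prodGrad_le φ
    have := mul_le_mul_of_nonneg_left hV1 (norm_nonneg (D.testToL2 φ))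
    linarith
  -- `B` lacks the Jacobian weight of the flattened coordinates; it is inserted at the cost of
  -- `m⁻¹`, since `m⁻¹ h ≥ 1`.
  have h3 : ∫ s in (0 : ℝ)..1, B s ≤
      (m⁻¹ * (D.L⁻¹ + 2 * K)) * (‖D.testToL2 φ‖ * ‖D.testToV φ‖) := by
    have e1 : ∫ s in (0 : ℝ)..1, B s = ∫ y in (0 : ℝ)..D.L, ∫ s in (0 : ℝ)..1, f (y, D.h y * s) :=
      intervalIntegral_intervalIntegral_swap
        (((Continuous.continuousOn (by fun_prop)).integrableOn_compact
          (isCompact_uIcc.prod isCompact_uIcc)).mono_set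
            (prod_mono uIoc_subset_uIcc uIoc_subset_uIcc))
    have e2 : ∫ y in (0 : ℝ)..D.L, ∫ s in (0 : ℝ)..1, f (y, D.h y * s) ≤
        ∫ y in (0 : ℝ)..D.L, m⁻¹ * ∫ s in (0 : ℝ)..1, D.h y * f (y, D.h y * s) := by
      refine intervalIntegral.integral_mono_on hL.le
        (Continuous.intervalIntegrable
          (intervalIntegral.continuous_parametric_intervalIntegral_of_continuous'
            (by fun_prop) _ _) _ _)
        (Continuous.intervalIntegrable (continuous_const.mul
          (intervalIntegral.continuous_parametric_intervalIntegral_of_continuous'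
            (by fun_prop) _ _)) _ _) fun y hy => ?_
      rw [intervalIntegral.integral_const_mul, ← mul_assoc]
      refine le_mul_of_one_le_left (intervalIntegral.integral_nonneg zero_le_one
        fun s _ => hf0 _) ?_
      rw [inv_mul_eq_div, one_le_div hm]
      exact (hb y hy).1
    rw [intervalIntegral.integral_const_mul, ← D.integral_dom hfc, hf, integral_add
      (D.integrableOn_dom_of_continuous (by fun_prop))
      (D.integrableOn_dom_of_continuous (by fun_prop)), integral_const_mul, integral_const_mul,
      D.integral_norm_sq_test φ] at e2
    rw [e1, mul_assoc]
    refine e2.trans (mul_le_mul_of_nonneg_left ?_ (inv_nonneg.2 hm.le))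
    rw [add_mul]
    refine add_le_add (mul_le_mul_of_nonneg_left ?_ (inv_nonneg.2 hL.le))
      (mul_le_mul_of_nonneg_left ?_ (by positivity))
    · rw [sq]
      exact mul_le_mul_of_nonneg_left hV0 (norm_nonneg _)
    · exact (D.integral_prodGrad_le φ).trans (mul_le_mul_of_nonneg_left hV1 (norm_nonneg _))
  have hA0 : 0 ≤ ∫ x in (0 : ℝ)..D.L, A x := intervalIntegral.integral_nonneg hL.le fun x _ =>
    mul_nonneg zero_le_two (intervalIntegral.integral_nonneg zero_le_one fun r _ =>
      mul_nonneg (D.h_pos x).le (D.prodGrad_nonneg φ _))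
  have h4 : ∫ x in (0 : ℝ)..D.L, ∫ s in (0 : ℝ)..1, M * (A x * B s) =
      M * ((∫ x in (0 : ℝ)..D.L, A x) * ∫ s in (0 : ℝ)..1, B s) := by
    simp only [intervalIntegral.integral_const_mul, intervalIntegral.integral_mul_const]
  rw [h4] at h1
  refine h1.trans ((mul_le_mul_of_nonneg_left (mul_le_mul h2 h3
    (intervalIntegral.integral_nonneg zero_le_one fun s _ =>
      intervalIntegral.integral_nonneg hL.le fun y _ => hf0 _) (by positivity)) hM.le).trans
    (le_of_eq (by ring)))

end Ladyzhenskaya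

instance isFiniteMeasure_mu : IsFiniteMeasure D.mu := by
  obtain ⟨K, hK, hs⟩ := D.dom_bounded
  exact ⟨by simpa using (measure_mono hs).trans_lt hK.measure_lt_top⟩

open Filter Topology ENNReal in
/-- Ladyzhenskaya's inequality on `V`. -/
theorem ladyzhenskaya : ∃ C : ℝ, 0 ≤ C ∧ ∀ u : D.V,
    eLpNorm (D.vel u) 4 D.mu ≤ ENNReal.ofReal (C * √(‖D.toH u‖ * ‖u‖)) := by
  obtain ⟨C, hC, hb⟩ := D.ladyzhenskaya_test
  have htest : ∀ φ : D.testSpace, eLpNorm (D.vel (D.testToV φ)) 4 D.mu ≤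
      ENNReal.ofReal (C ^ (4⁻¹ : ℝ) * √(‖D.toH (D.testToV φ)‖ * ‖D.testToV φ‖)) := by
    intro φ
    have e0 : eLpNorm (D.vel (D.testToV φ)) 4 D.mu =
        eLpNorm (φ : ℝ × ℝ → Vec2) 4 D.mu := eLpNorm_congr_ae (D.memLp_test φ).coeFn_toLp
    have hmem : MemLp (φ : ℝ × ℝ → Vec2) 4 D.mu := by
      have hc := D.continuous_test φ
      refine (integrable_norm_rpow_iff hc.aestronglyMeasurable (by simp) (by simp)).1 ?_
      exact D.integrableOn_dom_of_continuous (hc.norm.rpow_const fun _ => Or.inr (by simp))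
    rw [e0, hmem.eLpNorm_eq_integral_rpow_norm (by simp) (by simp)]
    refine ENNReal.ofReal_le_ofReal ?_
    have h4 := hb φ
    simp only [toReal_ofNat, Real.rpow_ofNat]
    refine (Real.rpow_le_rpow (integral_nonneg fun _ => by positivity) h4 (by norm_num)).trans ?_
    rw [Real.mul_rpow hC (by positivity)]
    refine mul_le_mul_of_nonneg_left (le_of_eq ?_) (by positivity)
    rw [Real.sqrt_eq_rpow, ← Real.rpow_natCast, ← Real.rpow_mul (by positivity)]
    norm_num
    rfl
  refine ⟨C ^ (4⁻¹ : ℝ), by positivity, fun u => ?_⟩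
  obtain ⟨a, ha, hau⟩ := mem_closure_iff_seq_limit.1 (D.denseRange_testToV u)
  have cvel : Continuous D.vel := by unfold vel; fun_prop
  have cH : Continuous D.toH := by
    unfold toH
    exact cvel.subtype_mk _
  -- Approximation in `V` gives convergence in `L²`, hence almost everywhere along a subsequence,
  -- and the `L⁴` norm is lower semicontinuous under such limits by Fatou's lemma.
  have h1 : TendstoInMeasure D.mu (fun n => (D.vel (a n) : ℝ × ℝ → Vec2)) atTop (D.vel u) :=
    tendstoInMeasure_of_tendsto_Lp ((cvel.tendsto u).comp hau)
  obtain ⟨ns, hns, hae⟩ := h1.exists_seq_tendsto_ae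
  refine (Lp.eLpNorm_lim_le_liminf_eLpNorm (fun n => (Lp.aestronglyMeasurable _)) _ hae).trans ?_
  have hlim : Tendsto (fun n => ENNReal.ofReal
      (C ^ (4⁻¹ : ℝ) * √(‖D.toH (a (ns n))‖ * ‖a (ns n)‖))) atTop
      (𝓝 (ENNReal.ofReal (C ^ (4⁻¹ : ℝ) * √(‖D.toH u‖ * ‖u‖)))) := by
    have hc : Continuous fun u => ENNReal.ofReal (C ^ (4⁻¹ : ℝ) * √(‖D.toH u‖ * ‖u‖)) :=
      ENNReal.continuous_ofReal.comp (by fun_prop)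
    exact (hc.tendsto u).comp (hau.comp hns.tendsto_atTop)
  rw [← hlim.liminf_eq]
  refine liminf_le_liminf (Eventually.of_forall fun n => ?_)
  obtain ⟨φ, hφ⟩ := ha (ns n)
  rw [← hφ]
  exact htest φ

theorem memLp_four_vel (u : D.V) : MemLp (D.vel u) 4 D.mu := by
  obtain ⟨C, -, hC⟩ := D.ladyzhenskaya
  exact ⟨Lp.aestronglyMeasurable _, (hC u).trans_lt ENNReal.ofReal_lt_top⟩

/-! ### The convection form on V -/

theorem abs_convection_le (a : Vec2) (G : Mat2) (c : Vec2) :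
    |∑ i, ∑ j, a j * G (i, j) * c i| ≤ 4 * (‖a‖ * ‖G‖ * ‖c‖) := by
  have h : ∀ i j, |a j * G (i, j) * c i| ≤ ‖a‖ * ‖G‖ * ‖c‖ := fun i j => by
    rw [abs_mul, abs_mul]
    have h1 := PiLp.norm_apply_le a j
    have h2 := PiLp.norm_apply_le G (i, j)
    have h3 := PiLp.norm_apply_le c i
    simp only [Real.norm_eq_abs] at h1 h2 h3
    gcongr
  refine (Finset.abs_sum_le_sum_abs _ _).trans ?_
  refine (Finset.sum_le_sum fun i _ => (Finset.abs_sum_le_sum_abs _ _).trans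
    (Finset.sum_le_sum fun j _ => h i j)).trans (le_of_eq ?_)
  simp only [Finset.sum_const, Finset.card_univ, Fintype.card_fin, nsmul_eq_mul]
  push_cast
  ring

/-- The integrand of the convection form. -/
def convection (u : ℝ × ℝ → Vec2) (G : ℝ × ℝ → Mat2) (w : ℝ × ℝ → Vec2) (x : ℝ × ℝ) : ℝ :=
  ∑ i, ∑ j, u x j * G x (i, j) * w x i

section Holder

variable {m : Measure (ℝ × ℝ)} {u w : ℝ × ℝ → Vec2} {G : ℝ × ℝ → Mat2}

theorem aestronglyMeasurable_convection (hu : AEStronglyMeasurable u m)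
    (hG : AEStronglyMeasurable G m) (hw : AEStronglyMeasurable w m) :
    AEStronglyMeasurable (convection u G w) m := by
  have hu' : ∀ j, AEStronglyMeasurable (fun x => u x j) m := fun j =>
    (EuclideanSpace.proj (𝕜 := ℝ) j).continuous.comp_aestronglyMeasurable hu
  have hw' : ∀ j, AEStronglyMeasurable (fun x => w x j) m := fun j =>
    (EuclideanSpace.proj (𝕜 := ℝ) j).continuous.comp_aestronglyMeasurable hw
  have hG' : ∀ j, AEStronglyMeasurable (fun x => G x j) m := fun j =>
    (EuclideanSpace.proj (𝕜 := ℝ) j).continuous.comp_aestronglyMeasurable hG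
  unfold convection
  simp only [Fin.sum_univ_two]
  exact ((((hu' 0).mul (hG' _)).mul (hw' _)).add (((hu' 1).mul (hG' _)).mul (hw' _))).add
    ((((hu' 0).mul (hG' _)).mul (hw' _)).add (((hu' 1).mul (hG' _)).mul (hw' _)))

instance holderTriple_four : ENNReal.HolderTriple 4 4 2 := ⟨by
  rw [← ENNReal.toReal_eq_toReal_iff' (by simp) (by simp), ENNReal.toReal_add (by simp) (by simp)]
  norm_num⟩

/-- Hölder with exponents `4, 2, 4`: the two velocities pair to `L²` and then meet the gradient. The
constant counts the four terms of the double sum. -/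
theorem eLpNorm_convection_le (hu : AEStronglyMeasurable u m)
    (hG : AEStronglyMeasurable G m) (hw : AEStronglyMeasurable w m) :
    eLpNorm (convection u G w) 1 m ≤
      4 * (eLpNorm u 4 m * eLpNorm G 2 m * eLpNorm w 4 m) := by
  have h1 : eLpNorm (fun x => ‖u x‖ * ‖w x‖) 2 m ≤ eLpNorm u 4 m * eLpNorm w 4 m := by
    have := eLpNorm_smul_le_mul_eLpNorm (p := 4) (q := 4) (r := 2) (μ := m) hw.norm hu.norm
    simp only [smul_eq_mul, eLpNorm_norm] at this
    exact this
  have h2 : eLpNorm (fun x => (‖u x‖ * ‖w x‖) * ‖G x‖) 1 m ≤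
      eLpNorm u 4 m * eLpNorm w 4 m * eLpNorm G 2 m := by
    have := eLpNorm_smul_le_mul_eLpNorm (p := 2) (q := 2) (r := 1) (μ := m) hG.norm
      (hu.norm.mul hw.norm)
    simp only [smul_eq_mul, eLpNorm_norm] at this
    exact this.trans (mul_le_mul_left h1 _)
  have h3 : eLpNorm (convection u G w) 1 m ≤
      eLpNorm ((4 : ℝ) • fun x => (‖u x‖ * ‖w x‖) * ‖G x‖) 1 m := by
    refine eLpNorm_mono fun x => ?_
    refine (abs_convection_le (u x) (G x) (w x)).trans ((le_of_eq ?_).trans (le_abs_self _))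
    simp only [Pi.smul_apply, smul_eq_mul]
    ring
  rw [eLpNorm_const_smul] at h3
  refine h3.trans ?_
  have : ‖(4 : ℝ)‖ₑ = 4 := by simp [enorm_eq_nnnorm]
  rw [this, mul_right_comm]
  exact mul_le_mul_right h2 _

theorem integrable_convection (hu : MemLp u 4 m) (hG : MemLp G 2 m) (hw : MemLp w 4 m) :
    Integrable (convection u G w) m := by
  rw [← memLp_one_iff_integrable]
  refine ⟨aestronglyMeasurable_convection hu.1 hG.1 hw.1,
    (eLpNorm_convection_le hu.1 hG.1 hw.1).trans_lt ?_⟩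
  exact ENNReal.mul_lt_top (by simp)
    (ENNReal.mul_lt_top (ENNReal.mul_lt_top hu.2 hG.2) hw.2)

end Holder

/-- The convection form on `V`. -/
def bV (u v w : D.V) : ℝ := D.bForm (D.vel u) (D.grad v) (D.vel w)

/-- The `L⁴` bound on velocities is what makes the integrand integrable; without it the integral
would default to zero and additivity of `bV` in each slot could fail. -/
theorem integrable_bV (u v w : D.V) :
    Integrable (convection (D.vel u) (D.grad v) (D.vel w)) D.mu :=
  integrable_convection (D.memLp_four_vel u) (Lp.memLp _) (D.memLp_four_vel w)

theorem bV_sub_left (u u' v w : D.V) : D.bV (u - u') v w = D.bV u v w - D.bV u' v w := by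
  refine Eq.trans ?_ (integral_sub (D.integrable_bV u v w) (D.integrable_bV u' v w))
  refine integral_congr_ae ?_
  filter_upwards [Lp.coeFn_sub (D.vel u) (D.vel u')] with x hx
  have e : D.vel (u - u') = D.vel u - D.vel u' := rfl
  simp only [e, hx, Fin.sum_univ_two, Pi.sub_apply, PiLp.sub_apply]
  ring

theorem bV_sub_mid (u v v' w : D.V) : D.bV u (v - v') w = D.bV u v w - D.bV u v' w := by
  refine Eq.trans ?_ (integral_sub (D.integrable_bV u v w) (D.integrable_bV u v' w))
  refine integral_congr_ae ?_
  filter_upwards [Lp.coeFn_sub (D.grad v) (D.grad v')] with x hx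
  have e : D.grad (v - v') = D.grad v - D.grad v' := rfl
  simp only [e, hx, Fin.sum_univ_two, Pi.sub_apply, PiLp.sub_apply]
  ring

theorem bV_sub_right (u v w w' : D.V) : D.bV u v (w - w') = D.bV u v w - D.bV u v w' := by
  refine Eq.trans ?_ (integral_sub (D.integrable_bV u v w) (D.integrable_bV u v w'))
  refine integral_congr_ae ?_
  filter_upwards [Lp.coeFn_sub (D.vel w) (D.vel w')] with x hx
  have e : D.vel (w - w') = D.vel w - D.vel w' := rfl
  simp only [e, hx, Fin.sum_univ_two, Pi.sub_apply, PiLp.sub_apply]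
  ring

/-- The estimate `|b(u, v, w)| ≤ C |u|^{1/2} ‖u‖^{1/2} ‖v‖ |w|^{1/2} ‖w‖^{1/2}`. -/
theorem abs_bV_le : ∃ C : ℝ, 0 ≤ C ∧ ∀ u v w : D.V,
    |D.bV u v w| ≤ C * (√(‖D.toH u‖ * ‖u‖) * ‖v‖ * √(‖D.toH w‖ * ‖w‖)) := by
  obtain ⟨C, hC0, hC⟩ := D.ladyzhenskaya
  refine ⟨4 * C * C, by positivity, fun u v w => ?_⟩
  have hG : eLpNorm (D.grad v) 2 D.mu ≤ ENNReal.ofReal ‖v‖ := by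
    refine ENNReal.le_ofReal_iff_toReal_le (Lp.eLpNorm_ne_top _) (norm_nonneg v) |>.2 ?_
    rw [← Lp.norm_def]
    exact WithLp.norm_snd_le (p := 2) (x := (v : D.H1Pair))
  have h := eLpNorm_convection_le (Lp.aestronglyMeasurable (D.vel u))
    (Lp.aestronglyMeasurable (D.grad v)) (Lp.aestronglyMeasurable (D.vel w))
  have h2 : ENNReal.ofReal |D.bV u v w| ≤
      eLpNorm (convection (D.vel u) (D.grad v) (D.vel w)) 1 D.mu := by
    rw [eLpNorm_one_eq_lintegral_enorm, ← Real.enorm_eq_ofReal_abs]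
    exact enorm_integral_le_lintegral_enorm _
  have h3 := h2.trans (h.trans (mul_le_mul_right (mul_le_mul' (mul_le_mul' (hC u) hG) (hC w)) 4))
  rw [← ENNReal.ofReal_mul (by positivity), ← ENNReal.ofReal_mul (by positivity),
    ← ENNReal.ofReal_ofNat 4, ← ENNReal.ofReal_mul (by positivity),
    ENNReal.ofReal_le_ofReal_iff (by positivity)] at h3
  exact h3.trans (le_of_eq (by ring))

/-- A cruder bound by the `V` norms alone, used for joint continuity and thereby for density
arguments. -/
theorem abs_bV_le_norm : ∃ C : ℝ, 0 ≤ C ∧ ∀ u v w : D.V,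
    |D.bV u v w| ≤ C * (‖u‖ * ‖v‖ * ‖w‖) := by
  obtain ⟨C, hC0, hC⟩ := D.abs_bV_le
  refine ⟨C, hC0, fun u v w => (hC u v w).trans ?_⟩
  have h : ∀ u : D.V, √(‖D.toH u‖ * ‖u‖) ≤ ‖u‖ := fun u =>
    Real.sqrt_le_iff.2 ⟨norm_nonneg u, by
      rw [sq]; exact mul_le_mul_of_nonneg_right (D.norm_toH_le u) (norm_nonneg u)⟩
  have hu := h u
  have hw := h w
  gcongr

open Filter Topology in
theorem continuous_bV : Continuous fun p : D.V × D.V × D.V => D.bV p.1 p.2.1 p.2.2 := by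
  obtain ⟨C, hC0, hC⟩ := D.abs_bV_le_norm
  refine continuous_iff_continuousAt.2 fun p => tendsto_iff_norm_sub_tendsto_zero.2 ?_
  refine squeeze_zero (fun _ => norm_nonneg _) (g := fun q : D.V × D.V × D.V =>
    C * (‖q.1 - p.1‖ * ‖q.2.1‖ * ‖q.2.2‖) + C * (‖p.1‖ * ‖q.2.1 - p.2.1‖ * ‖q.2.2‖) +
      C * (‖p.1‖ * ‖p.2.1‖ * ‖q.2.2 - p.2.2‖)) (fun q => ?_) ?_
  · have e : D.bV q.1 q.2.1 q.2.2 - D.bV p.1 p.2.1 p.2.2 = D.bV (q.1 - p.1) q.2.1 q.2.2 +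
        D.bV p.1 (q.2.1 - p.2.1) q.2.2 + D.bV p.1 p.2.1 (q.2.2 - p.2.2) := by
      rw [bV_sub_left, bV_sub_mid, bV_sub_right]
      ring
    rw [e]
    exact (norm_add₃_le).trans (add_le_add (add_le_add (hC _ _ _) (hC _ _ _)) (hC _ _ _))
  · refine Continuous.tendsto' (by fun_prop) _ _ ?_
    simp

/-- `b(u, v, v) = 0` on `V`. -/
theorem bV_self (u v : D.V) : D.bV u v v = 0 := by
  have hc := D.continuous_bV
  refine DenseRange.induction_on₂ (p := fun u v => D.bV u v v = 0) D.denseRange_testToV ?_ ?_ u v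
  · refine isClosed_eq ?_ continuous_const
    exact hc.comp (f := fun p : D.V × D.V => (p.1, p.2, p.2)) (by fun_prop)
  · intro φ ψ
    rw [← D.bForm_test_self φ ψ]
    refine integral_congr_ae ?_
    filter_upwards [(D.memLp_test φ).coeFn_toLp, (D.memLp_test ψ).coeFn_toLp,
      (D.memLp_gradField_test ψ).coeFn_toLp] with x h1 h2 h3
    have e1 : D.vel (D.testToV φ) = (D.memLp_test φ).toLp := rfl
    have e2 : D.vel (D.testToV ψ) = (D.memLp_test ψ).toLp := rfl
    have e3 : D.grad (D.testToV ψ) = (D.memLp_gradField_test ψ).toLp := rfl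
    rw [e1, e2, e3, h1, h2, h3]

/-! ### The friction functional, the norm of V, and the background flow -/

theorem j_nonneg {k : ℝ} (hk : 0 ≤ k) (u : D.V) : 0 ≤ D.j k u :=
  integral_nonneg fun _ => mul_nonneg hk (norm_nonneg _)

theorem j_zero (k : ℝ) : D.j k 0 = 0 := by
  rw [j, map_zero]
  refine (integral_congr_ae ?_).trans (integral_zero _ _)
  filter_upwards [Lp.coeFn_zero Vec2 2 (volume.restrict (Ioo 0 D.L))] with x hx
  rw [hx, Pi.zero_apply, norm_zero, mul_zero]

/-- The trace is continuous into `L²(Γ₀)²`, and on an interval of length `L` the `L¹` norm is at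
most `√L` times the `L²` norm. -/
theorem continuous_j (k : ℝ) : Continuous (D.j k) := by
  have h : Continuous fun f : Lp Vec2 2 (volume.restrict (Ioo 0 D.L)) => ∫ x in Ioo 0 D.L, ‖f x‖ := by
    have hi : ∀ f : Lp Vec2 2 (volume.restrict (Ioo 0 D.L)), Integrable f
        (volume.restrict (Ioo 0 D.L)) := fun f => (Lp.memLp f).integrable one_le_two
    refine LipschitzWith.continuous (K := (√D.L).toNNReal) (LipschitzWith.of_dist_le_mul
      fun f g => ?_)
    rw [Real.dist_eq, ← integral_sub (hi f).norm (hi g).norm, dist_eq_norm,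
      Real.coe_toNNReal _ (Real.sqrt_nonneg _)]
    have h1 : |∫ x in Ioo 0 D.L, (‖f x‖ - ‖g x‖)| ≤ ∫ x in Ioo 0 D.L, ‖(f - g) x‖ := by
      refine (abs_integral_le_integral_abs).trans (integral_mono_ae
        ((hi f).norm.sub (hi g).norm).abs (hi (f - g)).norm ?_)
      filter_upwards [Lp.coeFn_sub f g] with x hx
      rw [hx]
      exact abs_norm_sub_norm_le _ _
    refine h1.trans ?_
    have h2 := integral_mul_le_Lp_mul_Lq_of_nonneg (μ := volume.restrict (Ioo 0 D.L))
      Real.HolderConjugate.two_two (f := fun _ => 1) (g := fun x => ‖(f - g) x‖)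
      (ae_of_all _ fun _ => zero_le_one) (ae_of_all _ fun _ => norm_nonneg _)
      (memLp_const _) (by simpa using (Lp.memLp (f - g)).norm)
    have h3 : ∫ x in Ioo 0 D.L, ‖(f - g) x‖ ^ 2 = ‖f - g‖ ^ 2 := by
      rw [← real_inner_self_eq_norm_sq, L2.inner_def]
      simp only [real_inner_self_eq_norm_sq]
    simp only [one_mul, Real.rpow_two, h3] at h2
    rw [← Real.sqrt_eq_rpow, ← Real.sqrt_eq_rpow, Real.sqrt_sq (norm_nonneg _)] at h2
    simpa [D.L_pos.le] using h2
  unfold j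
  simp only [integral_const_mul]
  exact continuous_const.mul (h.comp D.trace.continuous)

theorem aForm_grad (u v : D.V) : D.aForm (D.grad u) (D.grad v) = inner ℝ (D.grad u) (D.grad v) :=
  rfl

/-- This replaces Poincaré's inequality: `|∇u|² = ‖u‖² - |u|²`, so viscosity controls the full norm
up to a term in `|u|²`, which Gronwall's inequality tolerates. -/
theorem norm_sq_eq (u : D.V) : ‖u‖ ^ 2 = ‖D.toH u‖ ^ 2 + ‖D.grad u‖ ^ 2 :=
  WithLp.prod_norm_sq_eq_of_L2 (u : D.H1Pair)

theorem norm_grad_le (u : D.V) : ‖D.grad u‖ ≤ ‖u‖ :=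
  WithLp.norm_snd_le (p := 2) (x := (u : D.H1Pair))

/-- The background flow belongs to `Ṽ`. -/
theorem background_mem {U₀ : ℝ} {U : ℝ → ℝ} (hU : D.IsBackground U₀ U) :
    background U ∈ D.testSpace := by
  have hs : ContDiff ℝ ∞ (background U) := by
    rw [contDiff_euclidean]
    intro i
    fin_cases i
    · exact hU.smooth.comp contDiff_snd
    · exact contDiff_const
  have hper : Function.Periodic (fun x => U (D.h x)) D.L := fun x => by
    simp only [D.h_periodic x]
  -- The top condition is assumed only over the open period; continuity adds the endpoints and
  -- periodicity the rest of the line.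
  have htop : ∀ x, U (D.h x) = 0 := by
    have hcl : ∀ x ∈ Icc 0 D.L, U (D.h x) = 0 := by
      have hcl : IsClosed {x | U (D.h x) = 0} :=
        isClosed_eq (hU.smooth.continuous.comp D.continuous_h) continuous_const
      rw [← closure_Ioo D.L_pos.ne]
      exact fun x hx => hcl.closure_subset_iff.2 hU.top hx
    intro x
    obtain ⟨y, hy, hxy⟩ := hper.exists_mem_Ico₀ D.L_pos x
    rw [hxy]
    exact hcl y ⟨hy.1, hy.2.le⟩
  refine ⟨hs, fun _ _ => rfl, fun x _ => ?_, fun x => ?_, fun _ => rfl⟩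
  · have hd := (hs.differentiable (by simp) x).hasFDerivAt
    have h0 : fderiv ℝ (background U) x (1, 0) = 0 := by
      have h1 := hd.comp_hasDerivAt (f := fun r => (r, x.2)) x.1
        ((hasDerivAt_id x.1).prodMk (hasDerivAt_const x.1 x.2))
      have h2 : HasDerivAt (background U ∘ fun r => (r, x.2)) 0 x.1 :=
        hasDerivAt_const x.1 (background U (0, x.2))
      exact h1.unique h2
    have h1 : fderiv ℝ (background U) x (0, 1) 1 = 0 := by
      have h1 := (EuclideanSpace.proj (𝕜 := ℝ) (1 : Fin 2)).hasFDerivAt.comp x hd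
      have h2 : HasFDerivAt (EuclideanSpace.proj (𝕜 := ℝ) (1 : Fin 2) ∘ background U)
        (0 : ℝ × ℝ →L[ℝ] ℝ) x := hasFDerivAt_const (0 : ℝ) x
      have h3 := congrArg (fun A => A (0, 1)) (h1.unique h2)
      simpa using h3
    rw [Fin.sum_univ_two, gradField_zero_apply, gradField_one_apply, h0, h1]
    simp
  · ext i
    fin_cases i
    · exact htop x
    · rfl

/-- The forcing in terms of the background flow as an element `ξ` of `V`. -/
theorem exists_forcing_eq {U₀ : ℝ} {U : ℝ → ℝ} (hU : D.IsBackground U₀ U) (ν : ℝ) :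
    ∃ ξ : D.V, ∀ v Θ : D.V, D.forcing ν U v Θ =
      -ν * inner ℝ (D.grad ξ) (D.grad Θ) - D.bV ξ v Θ - D.bV v ξ Θ := by
  set φ : D.testSpace := ⟨background U, D.background_mem hU⟩ with hφ
  refine ⟨D.testToV φ, fun v Θ => ?_⟩
  have e1 : D.vel (D.testToV φ) =ᵐ[D.mu] background U := (D.memLp_test φ).coeFn_toLp
  have e2 : D.grad (D.testToV φ) =ᵐ[D.mu] gradField (background U) :=
    (D.memLp_gradField_test φ).coeFn_toLp
  rw [← aForm_grad, forcing]
  refine congrArg₂ _ (congrArg₂ _ (congrArg _ ?_) ?_) ?_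
  · exact integral_congr_ae (e2.mono fun x hx => by simp only [hx])
  · exact integral_congr_ae (e1.mono fun x hx => by simp only [hx])
  · exact integral_congr_ae (e2.mono fun x hx => by simp only [hx])

end PeriodicChannel

/-! ### Weak derivatives in time, Gronwall's inequality, translations in L² -/

section TimeAnalysis

open Filter Topology

/-- Integration by parts for absolutely continuous functions; the primitive of an integrable `g` has
derivative `g` almost everywhere, and `ψ` vanishes at both ends. -/
theorem integral_primitive_mul_deriv {T : ℝ} (hT : 0 < T) {g : ℝ → ℝ}
    (hg : IntegrableOn g (Ioo 0 T)) {ψ : ℝ → ℝ} (hψ : ContDiff ℝ ∞ ψ)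
    (hs : tsupport ψ ⊆ Ioo 0 T) :
    ∫ t in Ioo 0 T, deriv ψ t * ∫ r in (0 : ℝ)..t, g r = - ∫ t in Ioo 0 T, ψ t * g t := by
  have hgi : IntervalIntegrable g volume 0 T := by
    rwa [intervalIntegrable_iff_integrableOn_Ioo_of_le hT.le]
  have hP := hgi.absolutelyContinuousOnInterval_intervalIntegral (c := 0) left_mem_uIcc
  have hψac : AbsolutelyContinuousOnInterval ψ 0 T :=
    (hψ.of_le (by simp)).contDiffOn.absolutelyContinuousOnInterval
  have key := hP.integral_mul_deriv_eq_deriv_mul hψac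
  have h0 : ψ 0 = 0 := image_eq_zero_of_notMem_tsupport fun h => lt_irrefl _ (hs h).1
  have h1 : ψ T = 0 := image_eq_zero_of_notMem_tsupport fun h => lt_irrefl _ (hs h).2
  rw [h0, h1, mul_zero, mul_zero, sub_zero, zero_sub, intervalIntegral.integral_of_le hT.le,
    intervalIntegral.integral_of_le hT.le, integral_Ioc_eq_integral_Ioo,
    integral_Ioc_eq_integral_Ioo] at key
  simp only [mul_comm (deriv ψ _)]
  rw [key, neg_inj]
  refine setIntegral_congr_ae measurableSet_Ioo ?_
  filter_upwards [hgi.ae_hasDerivAt_integral] with x hx hxI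
  rw [(hx (Ioo_subset_Icc_self.trans Icc_subset_uIcc hxI) 0 left_mem_uIcc).deriv, mul_comm]

/-- The du Bois-Reymond lemma: a continuous function with an integrable weak derivative is a
primitive of it. -/
theorem exists_eq_add_primitive {T : ℝ} (hT : 0 < T) {f g : ℝ → ℝ}
    (hf : ContinuousOn f (Icc 0 T)) (hg : IntegrableOn g (Ioo 0 T))
    (h : ∀ ψ : ℝ → ℝ, ContDiff ℝ ∞ ψ → HasCompactSupport ψ → tsupport ψ ⊆ Ioo 0 T →
      ∫ t in Ioo 0 T, deriv ψ t * f t = - ∫ t in Ioo 0 T, ψ t * g t) :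
    ∃ C, ∀ t ∈ Icc 0 T, f t = C + ∫ r in (0 : ℝ)..t, g r := by
  have hgi : IntegrableOn g (uIcc 0 T) := by
    rwa [uIcc_of_le hT.le, integrableOn_Icc_iff_integrableOn_Ioo]
  have hP : ContinuousOn (fun t => ∫ r in (0 : ℝ)..t, g r) (Icc 0 T) := by
    have := intervalIntegral.continuousOn_primitive_interval hgi
    rwa [uIcc_of_le hT.le] at this
  set F : ℝ → ℝ := fun t => f t - ∫ r in (0 : ℝ)..t, g r with hF
  have hFc : ContinuousOn F (Icc 0 T) := hf.sub hP
  have hint : ∀ (θ G : ℝ → ℝ), Continuous θ → ContinuousOn G (Icc 0 T) →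
      IntegrableOn (fun t => θ t * G t) (Ioo 0 T) := fun θ G hθ hG =>
    ((hθ.continuousOn.mul hG).integrableOn_compact isCompact_Icc).mono_set Ioo_subset_Icc_self
  have hweak : ∀ ψ : ℝ → ℝ, ContDiff ℝ ∞ ψ → HasCompactSupport ψ → tsupport ψ ⊆ Ioo 0 T →
      ∫ t in Ioo 0 T, deriv ψ t * F t = 0 := by
    intro ψ h1 h2 h3
    have hd := h1.continuous_deriv (by simp)
    simp only [hF, mul_sub]
    rw [integral_sub (hint _ _ hd hf) (hint _ _ hd hP), h ψ h1 h2 h3,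
      integral_primitive_mul_deriv hT hg h1 h3, sub_self]
  obtain ⟨η₀, s0, k0, c0, r0, e0⟩ := exists_contDiff_tsupport_subset (n := ⊤)
    (Ioo_mem_nhds (show (0 : ℝ) < T / 2 by linarith) (show T / 2 < T by linarith))
  have hc0 : 0 < ∫ x, η₀ x := c0.continuous.integral_pos_of_hasCompactSupport_nonneg_nonzero k0
    (fun x => (r0 ⟨x, rfl⟩).1) (x := T / 2) (by simp [e0])
  have hwhole : ∀ η G : ℝ → ℝ, tsupport η ⊆ Ioo 0 T →
      ∫ x in Ioo 0 T, η x * G x = ∫ x, η x * G x := fun η G hη =>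
    setIntegral_eq_integral_of_forall_compl_eq_zero fun x hx => by
      rw [image_eq_zero_of_notMem_tsupport fun h => hx (hη h), zero_mul]
  -- The only candidate for the constant: the mean of `F` weighted by a fixed bump function `η₀` of
  -- positive mass.
  set C : ℝ := (∫ x in Ioo 0 T, η₀ x * F x) / ∫ x, η₀ x with hC
  have hae : ∀ᵐ x, x ∈ Ioo 0 T → F x - C = 0 := by
    refine isOpen_Ioo.ae_eq_zero_of_integral_contDiff_smul_eq_zero
      (((hFc.mono Ioo_subset_Icc_self).sub continuousOn_const).locallyIntegrableOn
        measurableSet_Ioo) fun η h1 h2 h3 => ?_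
    -- Subtracting a multiple of `η₀` makes the integral of `θ` zero, so its primitive has compact
    -- support in `(0, T)` and is an admissible test function.
    set θ : ℝ → ℝ := fun x => (∫ x, η₀ x) * η x - (∫ x, η x) * η₀ x with hθ
    have hη1 : Integrable η := h1.continuous.integrable_of_hasCompactSupport h2
    have hη0 : Integrable η₀ := c0.continuous.integrable_of_hasCompactSupport k0
    have cθ : ContDiff ℝ ∞ θ := (contDiff_const.mul h1).sub (contDiff_const.mul c0)
    have iθ : ∫ x, θ x = 0 := by
      rw [hθ, integral_sub (hη1.const_mul _) (hη0.const_mul _), integral_const_mul,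
        integral_const_mul]
      ring
    have hK : IsCompact (tsupport η ∪ tsupport η₀) := h2.isCompact.union k0.isCompact
    have hKne : (tsupport η ∪ tsupport η₀).Nonempty :=
      ⟨T / 2, Or.inr (subset_tsupport _ (by simp [e0]))⟩
    obtain ⟨a, ha, ha'⟩ := hK.exists_isLeast hKne
    obtain ⟨b, hb, hb'⟩ := hK.exists_isGreatest hKne
    have hKs := union_subset h3 s0
    have sθ : ∀ x, x ∉ Icc a b → θ x = 0 := fun x hx => by
      have hx' : x ∉ tsupport η ∪ tsupport η₀ := fun h => hx ⟨ha' h, hb' h⟩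
      rw [mem_union, not_or] at hx'
      simp [hθ, image_eq_zero_of_notMem_tsupport hx'.1, image_eq_zero_of_notMem_tsupport hx'.2]
    have hψd : ∀ x, HasDerivAt (fun x => ∫ r in (0 : ℝ)..x, θ r) (θ x) x := fun x =>
      (cθ.continuous.integral_hasStrictDerivAt 0 x).hasDerivAt
    have hψd' : deriv (fun x => ∫ r in (0 : ℝ)..x, θ r) = θ := funext fun x => (hψd x).deriv
    have sψ : ∀ x, x ∉ Icc a b → ∫ r in (0 : ℝ)..x, θ r = 0 := fun x hx => by
      rcases lt_or_ge x a with hxa | hxa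
      · refine (intervalIntegral.integral_congr fun r hr => ?_).trans intervalIntegral.integral_zero
        refine sθ r fun h => ?_
        have := hr.2.trans (max_le (hKs ha).1.le hxa.le)
        rcases le_max_iff.1 hr.2 with h' | h'
        · exact absurd (h.1.trans h') (not_le.2 (hKs ha).1)
        · exact absurd (h.1.trans h') (not_le.2 hxa)
      · have hbx : b < x := lt_of_not_ge fun h => hx ⟨hxa, h⟩
        rw [intervalIntegral.integral_eq_integral_of_support_subset, iθ]
        intro r hr
        have : r ∈ Icc a b := by
          by_contra h
          exact hr (sθ r h)
        exact ⟨(hKs ha).1.trans_le this.1, this.2.trans hbx.le⟩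
    have tψ : tsupport (fun x => ∫ r in (0 : ℝ)..x, θ r) ⊆ Icc a b :=
      closure_minimal (fun x hx => by
        by_contra h
        exact hx (sψ x h)) isClosed_Icc
    have key := hweak (fun x => ∫ r in (0 : ℝ)..x, θ r)
      (contDiff_infty_iff_deriv.2 ⟨fun x => (hψd x).differentiableAt, by rwa [hψd']⟩)
      (HasCompactSupport.intro isCompact_Icc sψ)
      (tψ.trans (Icc_subset_Ioo (hKs ha).1 (hKs hb).2))
    rw [hψd'] at key
    simp only [hθ, sub_mul, mul_assoc] at key
    rw [integral_sub ((hint _ _ h1.continuous hFc).const_mul _)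
      ((hint _ _ c0.continuous hFc).const_mul _), integral_const_mul, integral_const_mul] at key
    simp only [smul_eq_mul]
    rw [← hwhole η (fun x => F x - C) h3]
    simp only [mul_sub]
    rw [integral_sub (hint _ _ h1.continuous hFc) (hint _ _ h1.continuous continuousOn_const),
      hwhole η (fun _ => C) h3, integral_mul_const, hC]
    field_simp
    linarith
  refine ⟨C, fun t ht => ?_⟩
  have hae' : F =ᵐ[volume.restrict (Icc 0 T)] fun _ => C := by
    rw [← restrict_Ioo_eq_restrict_Icc]
    exact (ae_restrict_iff' measurableSet_Ioo).2 (hae.mono fun x hx hxI => sub_eq_zero.1 (hx hxI))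
  have := Measure.eqOn_Icc_of_ae_eq volume hT.ne hae' hFc continuousOn_const ht
  simp only [hF] at this
  linarith

/-- Gronwall's inequality with an integrable coefficient. -/
theorem le_exp_mul_of_le_add_integral {y β : ℝ → ℝ} {a b : ℝ} (hab : a ≤ b)
    (hy : ContinuousOn y (Icc a b)) (hy0 : ∀ t ∈ Icc a b, 0 ≤ y t)
    (hβ : IntervalIntegrable β volume a b) (hβ0 : ∀ t, 0 ≤ β t)
    (h : ∀ s t, a ≤ s → s ≤ t → t ≤ b → y t ≤ y s + ∫ r in s..t, β r * y r) :
    y b ≤ Real.exp (2 * ∫ r in a..b, β r) * y a := by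
  have hsub : ∀ {s t}, a ≤ s → s ≤ t → t ≤ b → IntervalIntegrable β volume s t :=
    fun h1 h2 h3 => hβ.mono_set (by
      rw [uIcc_of_le h2, uIcc_of_le hab]
      exact Icc_subset_Icc h1 h3)
  set B : ℝ → ℝ := fun t => ∫ r in a..t, β r with hB
  have hBc : ContinuousOn B (Icc a b) := by
    have := intervalIntegral.continuousOn_primitive_interval' hβ left_mem_uIcc
    rwa [uIcc_of_le hab] at this
  have hBsub : ∀ s t, a ≤ s → s ≤ t → t ≤ b → ∫ r in s..t, β r = B t - B s :=
    fun s t h1 h2 h3 => by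
      simp only [hB]
      rw [← intervalIntegral.integral_add_adjacent_intervals (hsub le_rfl h1 (h2.trans h3))
        (hsub h1 h2 h3)]
      ring
  have hmono : ∀ s t, a ≤ s → s ≤ t → t ≤ b → B s ≤ B t := fun s t h1 h2 h3 => by
    have := intervalIntegral.integral_nonneg (μ := volume) h2 fun r _ => hβ0 r
    rw [hBsub s t h1 h2 h3] at this
    linarith
  -- Where `∫ β ≤ 1/2`, comparison at a maximum point `m` of `y` gives `(1 - δ) y(m) ≤ y(s)`. The
  -- factor `2` in the exponent comes from `(1 - δ) e^{2δ} ≥ (1 - δ)(1 + 2δ) ≥ 1` for `0 ≤ δ ≤ 1/2`.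
  have step : ∀ s t, a ≤ s → s ≤ t → t ≤ b → B t - B s ≤ 1 / 2 →
      y t ≤ Real.exp (2 * (B t - B s)) * y s := by
    intro s t h1 h2 h3 h4
    obtain ⟨m, hm, hmax⟩ := isCompact_Icc.exists_isMaxOn (nonempty_Icc.2 h2)
      (hy.mono (Icc_subset_Icc h1 h3))
    have e1 : ∫ r in s..m, β r * y r ≤ (B m - B s) * y m := by
      rw [← hBsub s m h1 hm.1 (hm.2.trans h3), ← intervalIntegral.integral_mul_const]
      have hi := hsub h1 hm.1 (hm.2.trans h3)
      refine intervalIntegral.integral_mono_on hm.1 (hi.mul_continuousOn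
        (hy.mono ?_)) (hi.mul_const _) fun r hr => ?_
      · rw [uIcc_of_le hm.1]
        exact Icc_subset_Icc h1 (hm.2.trans h3)
      · exact mul_le_mul_of_nonneg_left (hmax ⟨hr.1, hr.2.trans hm.2⟩) (hβ0 r)
    have e2 := h s m h1 hm.1 (hm.2.trans h3)
    have e3 : y t ≤ y m := hmax ⟨h2, le_rfl⟩
    have e4 := hmono m t (h1.trans hm.1) hm.2 h3
    have e5 := hmono s m h1 hm.1 (hm.2.trans h3)
    have ym := hy0 m ⟨h1.trans hm.1, hm.2.trans h3⟩
    have ys := hy0 s ⟨h1, h2.trans h3⟩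
    set δ := B t - B s with hδ
    have e6 : (1 - δ) * y m ≤ y s := by nlinarith
    have e7 : 1 ≤ (1 - δ) * Real.exp (2 * δ) := by
      have := Real.add_one_le_exp (2 * δ)
      nlinarith
    have e8 : (1 - δ) * Real.exp (2 * δ) * y m ≤ Real.exp (2 * δ) * y s := by
      have := mul_le_mul_of_nonneg_left e6 (Real.exp_pos (2 * δ)).le
      linarith
    nlinarith
  set S : Set ℝ := {t | y t ≤ Real.exp (2 * B t) * y a} with hS
  have hBa : B a = 0 := intervalIntegral.integral_same
  -- Continuous induction: the set is closed in `[a, b]`, and continuity of the primitive of `β`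
  -- lets the short-interval estimate extend it to the right of each of its points.
  have hall : Icc a b ⊆ S := by
    refine IsClosed.Icc_subset_of_forall_mem_nhdsWithin ?_ ?_ ?_
    · rw [inter_comm]
      have : ContinuousOn (fun t => Real.exp (2 * B t) * y a) (Icc a b) := by fun_prop
      exact isClosed_Icc.isClosed_le hy this
    · simp [hS, hBa]
    · rintro x ⟨hx, hxI⟩
      have hcx : ContinuousWithinAt B (Ioi x) x :=
        ((hBc x ⟨hxI.1, hxI.2.le⟩).mono (Icc_subset_Icc_left hxI.1)).mono_of_mem_nhdsWithin
          (Icc_mem_nhdsGT hxI.2)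
      have h1 : ∀ᶠ t in 𝓝[>] x, B t < B x + 1 / 2 :=
        hcx.eventually (gt_mem_nhds (by linarith))
      filter_upwards [h1, Ioc_mem_nhdsGT hxI.2] with t ht htI
      have e1 := step x t hxI.1 htI.1.le htI.2 (by linarith)
      have e2 := mul_le_mul_of_nonneg_left hx (Real.exp_pos (2 * (B t - B x))).le
      refine e1.trans (e2.trans (le_of_eq ?_))
      rw [← mul_assoc, ← Real.exp_add]
      congr 2
      ring
  exact hall (right_mem_Icc.2 hab)

/-- Translations are continuous in `L²`. -/
theorem tendsto_eLpNorm_translate_sub {E : Type*} [NormedAddCommGroup E] {f : ℝ → E}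
    (hf : MemLp f 2 volume) :
    Tendsto (fun h : ℝ => eLpNorm (fun r => f (r + h) - f r) 2 volume) (𝓝 0) (𝓝 0) := by
  set g : C(ℝ, C(ℝ, ℝ)) := (ContinuousMap.mk (fun p : ℝ × ℝ => p.2 + p.1) (by fun_prop)).curry
    with hg
  have hgm : ∀ a, MeasurePreserving (g a) volume volume := fun a =>
    measurePreserving_add_right volume a
  have h1 : Tendsto (fun h => Lp.compMeasurePreserving (g h) (hgm h) (hf.toLp f)) (𝓝 0)
      (𝓝 (Lp.compMeasurePreserving (g 0) (hgm 0) (hf.toLp f))) :=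
    tendsto_const_nhds.compMeasurePreservingLp (g.continuous.tendsto 0)
      hgm (hgm 0) (by simp)
  have h2 := tendsto_iff_edist_tendsto_0.1 h1
  refine h2.congr fun h => ?_
  rw [Lp.toLp_compMeasurePreserving, Lp.toLp_compMeasurePreserving, Lp.edist_toLp_toLp]
  congr 1
  funext r
  simp [hg]

end TimeAnalysis

/-! ### The energy identity and stability in the triple V ⊂ H ⊂ V' -/

section LionsMagenes

open Filter Topology

theorem MeasureTheory.MemLp.intervalIntegrable_of_one_le_two {E : Type*} [NormedAddCommGroup E]
    {f : ℝ → E} (hf : MemLp f 2 volume) (a b : ℝ) : IntervalIntegrable f volume a b :=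
  intervalIntegrable_iff.2 (((hf.locallyIntegrable one_le_two).integrableOn_isCompact
    isCompact_uIcc).mono_set uIoc_subset_uIcc)

theorem lintegral_enorm_mul_enorm_le {α E F : Type*} [MeasurableSpace α] {m : Measure α}
    [NormedAddCommGroup E] [NormedAddCommGroup F] {f : α → E} {g : α → F}
    (hf : AEStronglyMeasurable f m) (hg : AEStronglyMeasurable g m) :
    ∫⁻ x, ‖f x‖ₑ * ‖g x‖ₑ ∂m ≤ eLpNorm f 2 m * eLpNorm g 2 m := by
  have := ENNReal.lintegral_mul_le_Lp_mul_Lq m Real.HolderConjugate.two_two hf.enorm hg.enorm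
  simpa [eLpNorm_eq_lintegral_rpow_enorm_toReal] using this

theorem MeasureTheory.MemLp.integrable_apply {α V : Type*} [MeasurableSpace α] {m : Measure α}
    [NormedAddCommGroup V] [NormedSpace ℝ V] {G : α → StrongDual ℝ V} {Z : α → V}
    (hG : MemLp G 2 m) (hZ : MemLp Z 2 m) : Integrable (fun r => G r (Z r)) m := by
  have happ : Continuous fun p : StrongDual ℝ V × V => p.1 p.2 :=
    isBoundedBilinearMap_apply.continuous
  refine ⟨happ.comp_aestronglyMeasurable (hG.1.prodMk hZ.1), ?_⟩
  refine lt_of_le_of_lt (lintegral_mono fun r => ContinuousLinearMap.le_opENorm (G r) (Z r)) ?_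
  exact (lintegral_enorm_mul_enorm_le hG.1 hZ.1).trans_lt (ENNReal.mul_lt_top hG.2 hZ.2)

variable {V : Type*} [NormedAddCommGroup V] [NormedSpace ℝ V]

/-- The error splits as `(G(r + σ) - G(r))(Z(r) + Z(r + h)) + G(r)(Z(r + h) - Z(r))`. Each term
contains a translation difference of `L²` size at most `e`, and Cauchy–Schwarz in `r` handles the
other factor. -/
theorem lintegral_enorm_steklov_le {G : ℝ → StrongDual ℝ V} {Z : ℝ → V}
    (hG : StronglyMeasurable G) (hZ : StronglyMeasurable Z) {h : ℝ} (hh : 0 ≤ h)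
    {e : ENNReal} (heG : ∀ σ ∈ Ioc 0 h, eLpNorm (fun r => G (r + σ) - G r) 2 volume ≤ e)
    (heZ : eLpNorm (fun r => Z (r + h) - Z r) 2 volume ≤ e) :
    ∫⁻ r, ‖∫ σ in (0 : ℝ)..h, (G (r + σ) (Z r + Z (r + h)) - 2 * G r (Z r))‖ₑ ≤
      ENNReal.ofReal h * (e * (2 * eLpNorm Z 2 volume + eLpNorm G 2 volume)) := by
  have happ : Continuous fun p : StrongDual ℝ V × V => p.1 p.2 :=
    isBoundedBilinearMap_apply.continuous
  have hshift : ∀ {E : Type _} [NormedAddCommGroup E] {f : ℝ → E} (_ : StronglyMeasurable f)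
      (σ : ℝ), StronglyMeasurable fun r => f (r + σ) := fun hf σ =>
    hf.comp_measurable (measurable_add_const σ)
  have hm : StronglyMeasurable fun p : ℝ × ℝ =>
      G (p.1 + p.2) (Z p.1 + Z (p.1 + h)) - 2 * G p.1 (Z p.1) := by
    refine StronglyMeasurable.sub ?_ (StronglyMeasurable.const_mul ?_ 2)
    · exact happ.comp_stronglyMeasurable
        ((hG.comp_measurable (measurable_fst.add measurable_snd)).prodMk
          ((hZ.comp_measurable measurable_fst).add
            (hZ.comp_measurable (measurable_fst.add_const h))))
    · exact happ.comp_stronglyMeasurable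
        ((hG.comp_measurable measurable_fst).prodMk (hZ.comp_measurable measurable_fst))
  have h1 : ∀ r, ‖∫ σ in (0 : ℝ)..h, (G (r + σ) (Z r + Z (r + h)) - 2 * G r (Z r))‖ₑ ≤
      ∫⁻ σ in Ioc 0 h, ‖G (r + σ) (Z r + Z (r + h)) - 2 * G r (Z r)‖ₑ := fun r => by
    rw [intervalIntegral.integral_of_le hh]
    exact enorm_integral_le_lintegral_enorm _
  refine (lintegral_mono h1).trans ?_
  rw [lintegral_lintegral_swap hm.enorm.aemeasurable]
  have h2 : ∀ σ ∈ Ioc 0 h, ∫⁻ r, ‖G (r + σ) (Z r + Z (r + h)) - 2 * G r (Z r)‖ₑ ≤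
      e * (2 * eLpNorm Z 2 volume + eLpNorm G 2 volume) := by
    intro σ hσ
    have p : ∀ r, ‖G (r + σ) (Z r + Z (r + h)) - 2 * G r (Z r)‖ₑ ≤
        ‖G (r + σ) - G r‖ₑ * ‖Z r + Z (r + h)‖ₑ + ‖G r‖ₑ * ‖Z (r + h) - Z r‖ₑ := fun r => by
      have e1 : G (r + σ) (Z r + Z (r + h)) - 2 * G r (Z r) =
          (G (r + σ) - G r) (Z r + Z (r + h)) + G r (Z (r + h) - Z r) := by
        simp only [_root_.sub_apply, map_add, map_sub]
        ring
      rw [e1]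
      exact (enorm_add_le _ _).trans
        (add_le_add (ContinuousLinearMap.le_opENorm _ _) (ContinuousLinearMap.le_opENorm _ _))
    have mG := ((hshift hG σ).sub hG).aestronglyMeasurable (μ := volume)
    have mZ := (hZ.add (hshift hZ h)).aestronglyMeasurable (μ := volume)
    have mZ' := ((hshift hZ h).sub hZ).aestronglyMeasurable (μ := volume)
    refine (lintegral_mono p).trans ?_
    rw [lintegral_add_left' (by exact mG.enorm.mul mZ.enorm)]
    have q1 := lintegral_enorm_mul_enorm_le mG mZ
    have q2 := lintegral_enorm_mul_enorm_le (hG.aestronglyMeasurable (μ := volume)) mZ'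
    have q3 : eLpNorm (fun r => Z r + Z (r + h)) 2 volume ≤ 2 * eLpNorm Z 2 volume := by
      refine (eLpNorm_add_le hZ.aestronglyMeasurable (hshift hZ h).aestronglyMeasurable
        one_le_two).trans (le_of_eq ?_)
      rw [two_mul]
      congr 1
      exact eLpNorm_comp_measurePreserving hZ.aestronglyMeasurable
        (measurePreserving_add_right volume h)
    refine (add_le_add (q1.trans (mul_le_mul' (heG σ hσ) q3))
      (q2.trans (mul_le_mul' le_rfl heZ))).trans (le_of_eq ?_)
    ring
  refine (setLIntegral_mono' measurableSet_Ioc h2).trans (le_of_eq ?_)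
  rw [setLIntegral_const, Real.volume_Ioc, sub_zero, mul_comm]

/-- Integrate the difference identity over `[s, t]`, divide by `h` and let `h → 0+`. The left side
tends to `y t - y s` because `y` is continuous; the right side tends to `2 ∫ G(Z)` because
translations are continuous in `L²`. No regularization of `Z` or `G` is needed. -/
theorem sub_eq_two_mul_integral_of_steklov {G : ℝ → StrongDual ℝ V} {Z : ℝ → V}
    (hG : StronglyMeasurable G) (hZ : StronglyMeasurable Z) (hG2 : MemLp G 2 volume)
    (hZ2 : MemLp Z 2 volume) {y : ℝ → ℝ} (hy : Continuous y) {s t d : ℝ} (hst : s ≤ t)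
    (hd : 0 < d) (h : ∀ h ∈ Ioo 0 d, ∀ᵐ r, r ∈ Ioc s t →
      y (r + h) - y r = ∫ σ in (0 : ℝ)..h, G (r + σ) (Z r + Z (r + h))) :
    y t - y s = 2 * ∫ r in s..t, G r (Z r) := by
  have hGi : ∀ a b : ℝ, IntervalIntegrable G volume a b := hG2.intervalIntegrable_of_one_le_two
  have hGZ : Integrable fun r => G r (Z r) := hG2.integrable_apply hZ2
  set J := ∫ r in s..t, G r (Z r) with hJ
  set I : ℝ → ℝ := fun h => ∫ r in s..t, (y (r + h) - y r) with hI
  set K : ENNReal := 2 * eLpNorm Z 2 volume + eLpNorm G 2 volume with hK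
  have hKtop : K < ⊤ := ENNReal.add_lt_top.2 ⟨ENNReal.mul_lt_top (by simp) hZ2.2, hG2.2⟩
  have hlim : Tendsto (fun h => h⁻¹ * I h) (𝓝[>] 0) (𝓝 (y t - y s)) := by
    have hF : ∀ x, HasDerivAt (fun x => ∫ r in (0 : ℝ)..x, y r) (y x) x := fun x =>
      (hy.integral_hasStrictDerivAt 0 x).hasDerivAt
    have l := (hF t).tendsto_slope_zero_right.sub (hF s).tendsto_slope_zero_right
    refine l.congr fun h => ?_
    have hyi : ∀ a b, IntervalIntegrable y volume a b := fun a b => hy.intervalIntegrable a b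
    simp only [hI]
    rw [intervalIntegral.integral_sub (Continuous.intervalIntegrable (by fun_prop) _ _)
      (hyi _ _), intervalIntegral.integral_comp_add_right]
    simp only [smul_eq_mul]
    rw [← mul_sub]
    congr 1
    have e1 := intervalIntegral.integral_add_adjacent_intervals (hyi 0 (s + h)) (hyi (s + h) (t + h))
    have e2 := intervalIntegral.integral_add_adjacent_intervals (hyi 0 s) (hyi s t)
    linarith
  have hest : ∀ e : ℝ, 0 < e → |y t - y s - 2 * J| ≤ e * K.toReal := by
    intro e he
    have hG0 := (tendsto_eLpNorm_translate_sub hG2).eventually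
      (ge_mem_nhds (ENNReal.ofReal_pos.2 he))
    have hZ0 := (tendsto_eLpNorm_translate_sub hZ2).eventually
      (ge_mem_nhds (ENNReal.ofReal_pos.2 he))
    obtain ⟨δ, hδ, hball⟩ := Metric.eventually_nhds_iff.1 (hG0.and hZ0)
    refine le_of_tendsto (hlim.sub_const (2 * J)).abs ?_
    filter_upwards [Ioo_mem_nhdsGT (lt_min hd hδ)] with h₁ hh
    have hh0 := hh.1
    have hhd := hh.2.trans_le (min_le_left _ _)
    have hhδ := hh.2.trans_le (min_le_right _ _)
    have hest := lintegral_enorm_steklov_le hG hZ hh0.le (e := ENNReal.ofReal e)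
      (fun σ hσ => (hball (y := σ) (by
        rw [Real.dist_eq, sub_zero, abs_of_pos hσ.1]; linarith [hσ.2])).1)
      (hball (y := h₁) (by rw [Real.dist_eq, sub_zero, abs_of_pos hh0]; linarith)).2
    have e1 : I h₁ - h₁ * (2 * J) = ∫ r in s..t, (∫ σ in (0 : ℝ)..h₁,
        (G (r + σ) (Z r + Z (r + h₁)) - 2 * G r (Z r))) := by
      rw [hI, hJ, ← intervalIntegral.integral_const_mul, ← intervalIntegral.integral_const_mul,
        ← intervalIntegral.integral_sub (Continuous.intervalIntegrable (by fun_prop) _ _)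
          ((hGZ.const_mul _).const_mul _).intervalIntegrable]
      refine intervalIntegral.integral_congr_ae ?_
      rw [uIoc_of_le hst]
      filter_upwards [h h₁ ⟨hh0, hhd⟩] with r hr hrI
      have hGs : IntervalIntegrable (fun σ => G (r + σ)) volume 0 h₁ := by
        simpa using (hGi (r + 0) (r + h₁)).comp_add_left r
      have hGs' : IntervalIntegrable (fun σ => G (r + σ) (Z r + Z (r + h₁))) volume 0 h₁ := by
        rw [intervalIntegrable_iff] at hGs ⊢
        exact (ContinuousLinearMap.apply ℝ ℝ (Z r + Z (r + h₁))).integrable_comp hGs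
      rw [hr hrI, intervalIntegral.integral_sub hGs' intervalIntegrable_const]
      simp only [intervalIntegral.integral_const, sub_zero, smul_eq_mul]
    have e2 : ENNReal.ofReal |I h₁ - h₁ * (2 * J)| ≤
        ENNReal.ofReal h₁ * (ENNReal.ofReal e * K) := by
      refine le_trans ?_ hest
      rw [e1, ← Real.enorm_eq_ofReal_abs, intervalIntegral.integral_of_le hst]
      exact (enorm_integral_le_lintegral_enorm _).trans (setLIntegral_le_lintegral _ _)
    rw [← ENNReal.ofReal_toReal hKtop.ne, ← ENNReal.ofReal_mul he.le,
      ← ENNReal.ofReal_mul hh0.le, ENNReal.ofReal_le_ofReal_iff (by positivity)] at e2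
    have e3 : h₁⁻¹ * I h₁ - 2 * J = h₁⁻¹ * (I h₁ - h₁ * (2 * J)) := by
      field_simp
    rw [e3, abs_mul, abs_of_pos (inv_pos.2 hh0), inv_mul_le_iff₀ hh0]
    exact e2
  have h0 : |y t - y s - 2 * J| ≤ 0 := by
    refine ge_of_tendsto (f := fun e : ℝ => e * K.toReal) (x := 𝓝[>] 0) ?_
      (eventually_mem_nhdsWithin.mono fun e he => hest e he)
    refine (Continuous.tendsto' (by fun_prop) _ _ (by simp)).mono_left nhdsWithin_le_nhds
  linarith [abs_eq_zero.1 (le_antisymm h0 (abs_nonneg _))]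

/-- Extension by zero makes translates available on the whole line, and a strongly measurable
representative makes `(r, σ) ↦ G (r + σ)` jointly measurable. -/
theorem MeasureTheory.MemLp.exists_stronglyMeasurable_extension {E : Type*}
    [NormedAddCommGroup E] {f : ℝ → E} {a b : ℝ} (hf : MemLp f 2 (volume.restrict (Ioo a b))) :
    ∃ g : ℝ → E, StronglyMeasurable g ∧ MemLp g 2 volume ∧ ∀ᵐ r, r ∈ Ioo a b → g r = f r := by
  refine ⟨(Ioo a b).indicator (hf.1.mk f), hf.1.stronglyMeasurable_mk.indicator measurableSet_Ioo,
    (memLp_indicator_iff_restrict measurableSet_Ioo).2 (hf.ae_eq hf.1.ae_eq_mk), ?_⟩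
  filter_upwards [(ae_restrict_iff' measurableSet_Ioo).1 hf.1.ae_eq_mk] with r hr hrI
  rw [indicator_of_mem hrI, hr hrI]

/-- The Lions–Magenes lemma: the energy identity for a function in `C([0, T]; H) ∩ L²(0, T; V)`
with time derivative in `L²(0, T; V')`. -/
theorem norm_sq_sub_norm_sq_eq {H : Type*} [NormedAddCommGroup H] [InnerProductSpace ℝ H]
    (ι : V → H) {T : ℝ} {z : ℝ → H} {Z : ℝ → V} {G : ℝ → StrongDual ℝ V}
    (hz : ContinuousOn z (Icc 0 T)) (hZ : MemLp Z 2 (volume.restrict (Ioo 0 T)))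
    (hzZ : ∀ᵐ r ∂(volume.restrict (Ioo 0 T)), ι (Z r) = z r)
    (hG : MemLp G 2 (volume.restrict (Ioo 0 T)))
    (hprim : ∀ a b, 0 ≤ a → a ≤ b → b ≤ T → ∀ Θ : V,
      inner ℝ (z b) (ι Θ) - inner ℝ (z a) (ι Θ) = ∫ r in a..b, G r Θ)
    {s t : ℝ} (hs : 0 ≤ s) (hst : s ≤ t) (ht : t < T) :
    ‖z t‖ ^ 2 - ‖z s‖ ^ 2 = 2 * ∫ r in s..t, G r (Z r) := by
  have hT : 0 ≤ T := (hs.trans hst).trans ht.le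
  obtain ⟨Z', sZ, mZ, eZ⟩ := hZ.exists_stronglyMeasurable_extension
  obtain ⟨G', sG, mG, eG⟩ := hG.exists_stronglyMeasurable_extension
  have hz' : ∀ᵐ r, r ∈ Ioo 0 T → ι (Z' r) = z r := by
    filter_upwards [(ae_restrict_iff' measurableSet_Ioo).1 hzZ, eZ] with r h1 h2 hrI
    rw [h2 hrI, h1 hrI]
  have hne : ∀ a : ℝ, ∀ᵐ r : ℝ, r ≠ a := fun a => by simp [ae_iff, measure_singleton]
  have hprim' : ∀ a b, 0 ≤ a → a ≤ b → b ≤ T → ∀ Θ : V,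
      inner ℝ (z b) (ι Θ) - inner ℝ (z a) (ι Θ) = ∫ r in a..b, G' r Θ := by
    intro a b h0 h1 h2 Θ
    rw [hprim a b h0 h1 h2 Θ]
    refine intervalIntegral.integral_congr_ae ?_
    rw [uIoc_of_le h1]
    filter_upwards [eG, hne T] with r hr hrT hrI
    rw [hr ⟨h0.trans_lt hrI.1, lt_of_le_of_ne (hrI.2.trans h2) hrT⟩]
  set y : ℝ → ℝ := IccExtend hT ((Icc 0 T).domRestrict fun r => ‖z r‖ ^ 2) with hy
  have cy : Continuous y := (continuousOn_iff_continuous_domRestrict.1 (hz.norm.pow 2)).Icc_extend'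
  have ey : ∀ r, 0 ≤ r → r ≤ T → y r = ‖z r‖ ^ 2 := fun r h0 h1 => by
    rw [hy, IccExtend_of_mem hT _ ⟨h0, h1⟩]
    rfl
  -- For almost every `r`, `‖z(r + h)‖² - ‖z(r)‖²` is the inner product of `z(r + h) - z(r)` with
  -- `z(r + h) + z(r)`. The sum is the image of a fixed element of `V`, so the weak primitive
  -- formula applies to it. Taking `h < T - t` keeps `r + h` inside the interval, which is why `t <
  -- T` is strict.
  have key := sub_eq_two_mul_integral_of_steklov sG sZ mG mZ cy hst (sub_pos.2 ht) (fun h hh => by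
    have hshift : ∀ᵐ r, r + h ∈ Ioo 0 T → ι (Z' (r + h)) = z (r + h) :=
      (measurePreserving_add_right volume h).quasiMeasurePreserving.ae hz'
    filter_upwards [hz', hshift] with r h1 h2 hr
    have r0 : 0 < r := hs.trans_lt hr.1
    have rT : r + h < T := by linarith [hr.2, hh.2]
    have hh0 := hh.1
    have hGs : IntervalIntegrable (fun σ => G' (r + σ)) volume 0 h := by
      simpa using (mG.intervalIntegrable_of_one_le_two (r + 0) (r + h)).comp_add_left r
    have hGs' : ∀ Θ, IntervalIntegrable (fun σ => G' (r + σ) Θ) volume 0 h := fun Θ => by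
      rw [intervalIntegrable_iff] at hGs ⊢
      exact (ContinuousLinearMap.apply ℝ ℝ Θ).integrable_comp hGs
    have p := fun Θ => hprim' r (r + h) r0.le (by linarith) rT.le Θ
    have q : ∀ Θ, ∫ σ in (0 : ℝ)..h, G' (r + σ) Θ = ∫ x in r..r + h, G' x Θ := fun Θ => by
      rw [intervalIntegral.integral_comp_add_left (fun x => G' x Θ), add_zero]
    simp only [map_add]
    rw [intervalIntegral.integral_add (hGs' _) (hGs' _), q, q, ← p, ← p,
      h1 ⟨r0, by linarith⟩, h2 ⟨by linarith, rT⟩, ey _ (by linarith) rT.le,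
      ey _ r0.le (by linarith), real_inner_self_eq_norm_sq, real_inner_self_eq_norm_sq,
      real_inner_comm (z r) (z (r + h))]
    ring)
  rw [ey t (hs.trans hst) ht.le, ey s hs (hst.trans ht.le)] at key
  rw [key]
  congr 1
  refine intervalIntegral.integral_congr_ae ?_
  rw [uIoc_of_le hst]
  filter_upwards [eG, eZ] with r h1 h2 hr
  have : r ∈ Ioo 0 T := ⟨hs.trans_lt hr.1, hr.2.trans_lt ht⟩
  rw [h1 this, h2 this]

end LionsMagenes

theorem norm_sq_sub_norm_sq_le {V H : Type*} [NormedAddCommGroup V] [NormedSpace ℝ V]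
    [NormedAddCommGroup H] [InnerProductSpace ℝ H]
    (ι : V → H) {T : ℝ} {z : ℝ → H} {Z : ℝ → V} {G : ℝ → StrongDual ℝ V}
    (hz : ContinuousOn z (Icc 0 T)) (hZ : MemLp Z 2 (volume.restrict (Ioo 0 T)))
    (hzZ : ∀ᵐ r ∂(volume.restrict (Ioo 0 T)), ι (Z r) = z r)
    (hG : MemLp G 2 (volume.restrict (Ioo 0 T)))
    (hprim : ∀ a b, 0 ≤ a → a ≤ b → b ≤ T → ∀ Θ : V,
      inner ℝ (z b) (ι Θ) - inner ℝ (z a) (ι Θ) = ∫ r in a..b, G r Θ)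
    {γ : ℝ → ℝ} (hγ : IntegrableOn γ (Ioo 0 T))
    (hle : ∀ᵐ r ∂(volume.restrict (Ioo 0 T)), 2 * G r (Z r) ≤ γ r)
    {s t : ℝ} (hs : 0 ≤ s) (hst : s ≤ t) (ht : t < T) :
    ‖z t‖ ^ 2 ≤ ‖z s‖ ^ 2 + ∫ r in s..t, γ r := by
  have h := norm_sq_sub_norm_sq_eq ι hz hZ hzZ hG hprim hs hst ht
  have hsub : Ioc s t ⊆ Ioo 0 T := fun r hr => ⟨hs.trans_lt hr.1, hr.2.trans_lt ht⟩
  have hi : IntegrableOn (fun r => G r (Z r)) (Ioo 0 T) := hG.integrable_apply hZ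
  have hmono : ∫ r in s..t, 2 * G r (Z r) ≤ ∫ r in s..t, γ r := by
    rw [intervalIntegral.integral_of_le hst, intervalIntegral.integral_of_le hst]
    exact integral_mono_ae ((hi.mono_set hsub).const_mul 2) (hγ.mono_set hsub)
      (ae_restrict_of_ae_restrict_of_subset hsub hle)
  rw [intervalIntegral.integral_const_mul] at hmono
  linarith

/-- Stability in `H` of functions whose difference satisfies a differential inequality. -/
theorem norm_sq_sub_le_exp_mul {V H : Type*} [NormedAddCommGroup V] [NormedSpace ℝ V]
    [NormedAddCommGroup H] [InnerProductSpace ℝ H] {ι : V → H}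
    (hι : ∀ a b, ι (a - b) = ι a - ι b) {T : ℝ} {v w : ℝ → H} {vV wV : ℝ → V}
    {vt wt : ℝ → StrongDual ℝ V} (hv : ContinuousOn v (Icc 0 T)) (hw : ContinuousOn w (Icc 0 T))
    (hvV : MemLp vV 2 (volume.restrict (Ioo 0 T))) (hwV : MemLp wV 2 (volume.restrict (Ioo 0 T)))
    (hvι : ∀ᵐ r ∂(volume.restrict (Ioo 0 T)), ι (vV r) = v r)
    (hwι : ∀ᵐ r ∂(volume.restrict (Ioo 0 T)), ι (wV r) = w r)
    (hvt : MemLp vt 2 (volume.restrict (Ioo 0 T))) (hwt : MemLp wt 2 (volume.restrict (Ioo 0 T)))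
    (hvp : ∀ a b, 0 ≤ a → a ≤ b → b ≤ T → ∀ Θ : V,
      inner ℝ (v b) (ι Θ) - inner ℝ (v a) (ι Θ) = ∫ r in a..b, vt r Θ)
    (hwp : ∀ a b, 0 ≤ a → a ≤ b → b ≤ T → ∀ Θ : V,
      inner ℝ (w b) (ι Θ) - inner ℝ (w a) (ι Θ) = ∫ r in a..b, wt r Θ)
    {β : ℝ → ℝ} (hβ : IntegrableOn β (Ioo 0 T)) (hβ0 : ∀ r, 0 ≤ β r)
    (hle : ∀ᵐ r ∂(volume.restrict (Ioo 0 T)),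
      2 * (wt r - vt r) (wV r - vV r) ≤ β r * ‖w r - v r‖ ^ 2)
    {τ t : ℝ} (hτ : 0 ≤ τ) (hτt : τ ≤ t) (ht : t < T) :
    ‖w t - v t‖ ^ 2 ≤ Real.exp (2 * ∫ r in τ..t, β r) * ‖w τ - v τ‖ ^ 2 := by
  have hcz : ContinuousOn (fun r => w r - v r) (Icc 0 T) := hw.sub hv
  have hcy : ContinuousOn (fun r => ‖w r - v r‖ ^ 2) (Icc 0 T) := hcz.norm.pow 2
  have hsub : Icc τ t ⊆ Icc 0 T := Icc_subset_Icc hτ ht.le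
  have hβI : IntegrableOn β (Icc 0 T) := by rwa [integrableOn_Icc_iff_integrableOn_Ioo]
  have hprim : ∀ a b, 0 ≤ a → a ≤ b → b ≤ T → ∀ Θ : V,
      inner ℝ (w b - v b) (ι Θ) - inner ℝ (w a - v a) (ι Θ) = ∫ r in a..b, (wt r - vt r) Θ := by
    intro a b h0 h1 h2 Θ
    have hii : ∀ {g : ℝ → StrongDual ℝ V}, MemLp g 2 (volume.restrict (Ioo 0 T)) →
        IntervalIntegrable (fun r => g r Θ) volume a b := fun {g} hg => by
      have hi : IntegrableOn (fun r => g r Θ) (Ioo 0 T) := hg.integrable_apply (memLp_const Θ)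
      exact (intervalIntegrable_iff_integrableOn_Ioo_of_le h1).2
        (hi.mono_set (Ioo_subset_Ioo h0 h2))
    have := intervalIntegral.integral_sub (hii hwt) (hii hvt)
    simp only [_root_.sub_apply]
    rw [this, ← hwp a b h0 h1 h2, ← hvp a b h0 h1 h2, inner_sub_left, inner_sub_left]
    ring
  have hγ : IntegrableOn (fun r => β r * ‖w r - v r‖ ^ 2) (Ioo 0 T) :=
    (hβI.mul_continuousOn hcy isCompact_Icc).mono_set Ioo_subset_Icc_self
  refine le_exp_mul_of_le_add_integral (y := fun r => ‖w r - v r‖ ^ 2) hτt (hcy.mono hsub)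
    (fun _ _ => sq_nonneg _) ((intervalIntegrable_iff_integrableOn_Icc_of_le hτt).2
      (hβI.mono_set hsub)) hβ0 fun a b h0 h1 h2 => ?_
  refine norm_sq_sub_norm_sq_le (Z := fun r => wV r - vV r) (G := fun r => wt r - vt r) ι hcz
    (hwV.sub hvV) ?_ (hwt.sub hvt) hprim hγ hle (hτ.trans h0) h1 (h2.trans_lt ht)
  filter_upwards [hvι, hwι] with r h1 h2
  rw [hι, h1, h2]

/-- A continuous function with values in a dual space is the weak-star primitive of its
distributional derivative. -/
theorem apply_sub_apply_eq_integral_of_weakDeriv {V : Type*} [NormedAddCommGroup V]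
    [NormedSpace ℝ V] {T : ℝ} (hT : 0 < T) {f g : ℝ → StrongDual ℝ V}
    (hf : ContinuousOn f (Icc 0 T)) (hg : MemLp g 2 (volume.restrict (Ioo 0 T)))
    (h : ∀ ψ : ℝ → ℝ, ContDiff ℝ ∞ ψ → HasCompactSupport ψ → tsupport ψ ⊆ Ioo 0 T →
      ∫ t in Ioo 0 T, deriv ψ t • f t = - ∫ t in Ioo 0 T, ψ t • g t)
    {a b : ℝ} (ha : 0 ≤ a) (hab : a ≤ b) (hb : b ≤ T) (Θ : V) :
    f b Θ - f a Θ = ∫ r in a..b, g r Θ := by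
  have hgi : Integrable g (volume.restrict (Ioo 0 T)) := hg.integrable one_le_two
  have hgΘ : IntegrableOn (fun r => g r Θ) (Ioo 0 T) :=
    (ContinuousLinearMap.apply ℝ ℝ Θ).integrable_comp hgi
  have hcont : ContinuousOn (fun t => f t Θ) (Icc 0 T) :=
    (ContinuousLinearMap.apply ℝ ℝ Θ).continuous.comp_continuousOn hf
  obtain ⟨C, hC⟩ := exists_eq_add_primitive hT hcont hgΘ fun ψ h1 h2 h3 => by
    -- Evaluation at `Θ` turns the `V'`-valued identity into a scalar one; it passes through the
    -- integrals because both integrands are integrable.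
    have key := congrArg (fun A : StrongDual ℝ V => A Θ) (h ψ h1 h2 h3)
    have i1 : Integrable (fun t => deriv ψ t • f t) (volume.restrict (Ioo 0 T)) :=
      IntegrableOn.mono_set (ContinuousOn.integrableOn_compact isCompact_Icc
        ((h1.continuous_deriv (by simp)).continuousOn.smul hf)) Ioo_subset_Icc_self
    have i2 : Integrable (fun t => ψ t • g t) (volume.restrict (Ioo 0 T)) := by
      obtain ⟨M, hM⟩ := h1.continuous.bounded_above_of_compact_support h2
      exact hgi.bdd_smul M h1.continuous.aestronglyMeasurable (ae_of_all _ hM)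
    simp only [_root_.neg_apply] at key
    rw [ContinuousLinearMap.integral_apply i1, ContinuousLinearMap.integral_apply i2] at key
    exact key
  have hi : ∀ c d, c ∈ Icc 0 T → d ∈ Icc 0 T → IntervalIntegrable (fun r => g r Θ) volume c d :=
    fun c d hc hd => by
      have : IntervalIntegrable (fun r => g r Θ) volume 0 T := by
        rwa [intervalIntegrable_iff_integrableOn_Ioo_of_le hT.le]
      refine this.mono_set ?_
      rw [uIcc_of_le hT.le]
      exact uIcc_subset_Icc hc hd
  have ha' : a ∈ Icc 0 T := ⟨ha, hab.trans hb⟩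
  have hb' : b ∈ Icc 0 T := ⟨ha.trans hab, hb⟩
  have h0 : (0 : ℝ) ∈ Icc 0 T := ⟨le_rfl, hT.le⟩
  rw [hC b hb', hC a ha', ← intervalIntegral.integral_add_adjacent_intervals (hi 0 a h0 ha')
    (hi a b ha' hb')]
  ring

/-! ### Estimates from the variational inequality at a fixed time -/

namespace PeriodicChannel

variable (D : PeriodicChannel)

theorem toH_sub (u v : D.V) : D.toH (u - v) = D.toH u - D.toH v := rfl

theorem continuous_toVDual : Continuous D.toVDual := by
  let A : D.H →ₗ[ℝ] D.VDual :=
    { toFun := D.toVDual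
      map_add' := fun f g => by
        ext Θ
        exact inner_add_left f g (D.toH Θ)
      map_smul' := fun c f => by
        ext Θ
        exact real_inner_smul_left f (D.toH Θ) c }
  exact AddMonoidHomClass.continuous_of_bound A 1 fun f => by
    rw [one_mul]
    exact ContinuousLinearMap.opNorm_le_bound _ (norm_nonneg f) fun Θ =>
      (norm_inner_le_norm f (D.toH Θ)).trans
        (mul_le_mul_of_nonneg_left (D.norm_toH_le Θ) (norm_nonneg f))

theorem IsWeakTimeDeriv.inner_sub_inner_eq {T : ℝ} (hT : 0 < T) {v : ℝ → D.H} {g : ℝ → D.VDual}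
    (hv : ContinuousOn v (Icc 0 T)) (hg : MemLp g 2 (volume.restrict (Ioo 0 T)))
    (h : D.IsWeakTimeDeriv T v g) {a b : ℝ} (ha : 0 ≤ a) (hab : a ≤ b) (hb : b ≤ T) (Θ : D.V) :
    inner ℝ (v b) (D.toH Θ) - inner ℝ (v a) (D.toH Θ) = ∫ r in a..b, g r Θ :=
  apply_sub_apply_eq_integral_of_weakDeriv hT (D.continuous_toVDual.comp_continuousOn hv) hg h
    ha hab hb Θ

/-- The variational inequality at a fixed time, for all test functions. -/
def VarIneq (ν k : ℝ) (U : ℝ → ℝ) (g : D.VDual) (v : D.V) : Prop :=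
  ∀ Θ : D.V, D.forcing ν U v (Θ - v) ≤
    g (Θ - v) + ν * D.aForm (D.grad v) (D.grad (Θ - v)) + D.bForm (D.vel v) (D.grad v)
      (D.vel (Θ - v)) + D.j k Θ - D.j k v

theorem separableSpace_V : TopologicalSpace.SeparableSpace D.V := by
  have : Fact ((2 : ENNReal) ≠ ⊤) := ⟨by simp⟩
  have h1 : SecondCountableTopology D.L2Vec := MeasureTheory.Lp.SecondCountableTopology
  have h2 : SecondCountableTopology D.L2Mat := MeasureTheory.Lp.SecondCountableTopology
  have h : SecondCountableTopology D.H1Pair :=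
    (WithLp.homeomorphProd 2 D.L2Vec D.L2Mat).secondCountableTopology
  infer_instance

/-- With `v` and `g` fixed, both sides are continuous in `Θ`, including the `j` term, so the
inequality passes to the closure of `S`. -/
theorem varIneq_of_dense {U₀ : ℝ} {U : ℝ → ℝ} (hU : D.IsBackground U₀ U) {ν k : ℝ}
    {g : D.VDual} {v : D.V} {S : Set D.V} (hS : Dense S)
    (h : ∀ Θ ∈ S, D.forcing ν U v (Θ - v) ≤
      g (Θ - v) + ν * D.aForm (D.grad v) (D.grad (Θ - v)) + D.bForm (D.vel v) (D.grad v)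
        (D.vel (Θ - v)) + D.j k Θ - D.j k v) : D.VarIneq ν k U g v := by
  obtain ⟨ξ, hξ⟩ := D.exists_forcing_eq hU ν
  have cg : Continuous D.grad := by unfold grad; fun_prop
  have cb : ∀ u w : D.V, Continuous fun Θ => D.bV u w (Θ - v) := fun u w =>
    D.continuous_bV.comp (f := fun Θ => (u, w, Θ - v)) (by fun_prop)
  have ca : ∀ G : D.L2Mat, Continuous fun Θ : D.V => inner ℝ G (D.grad (Θ - v)) := fun G =>
    continuous_const.inner (cg.comp (continuous_id.sub continuous_const))
  refine fun Θ => hS.induction (P := fun Θ => _ ≤ _) h ?_ Θ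
  refine isClosed_le ?_ ?_
  · simp only [hξ]
    exact ((continuous_const.mul (ca _)).sub (cb _ _)).sub (cb _ _)
  · refine Continuous.sub (Continuous.add (Continuous.add (Continuous.add ?_ ?_) (cb v v))
      (D.continuous_j k)) continuous_const
    · fun_prop
    · exact continuous_const.mul (ca _)

/-- With the first and third arguments equal, the two square roots multiply to `|u| ‖u‖`: one power
of `‖u‖` is left over for Young's inequality against the viscosity. -/
theorem abs_bV_diag_le : ∃ C : ℝ, 0 ≤ C ∧ ∀ u v : D.V,
    |D.bV u v u| ≤ C * (‖D.toH u‖ * ‖u‖ * ‖v‖) := by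
  obtain ⟨C, hC0, hC⟩ := D.abs_bV_le
  refine ⟨C, hC0, fun u v => (hC u v u).trans (le_of_eq ?_)⟩
  rw [mul_right_comm (√_), Real.mul_self_sqrt (by positivity)]

theorem bV_zero_right (u v : D.V) : D.bV u v 0 = 0 := by
  have := D.bV_sub_right u v 0 0
  rwa [sub_zero, sub_self] at this

/-- The energy estimate at a fixed time. -/
theorem VarIneq.energy {U₀ : ℝ} {U : ℝ → ℝ} (hU : D.IsBackground U₀ U) {ν k : ℝ} (hν : 0 < ν)
    (hk : 0 < k) : ∃ A : ℝ, 0 ≤ A ∧ ∀ (g : D.VDual) (v : D.V), D.VarIneq ν k U g v →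
      g v ≤ -(ν / 2) * ‖v‖ ^ 2 + A * (1 + ‖D.toH v‖ ^ 2) := by
  obtain ⟨ξ, hξ⟩ := D.exists_forcing_eq hU ν
  obtain ⟨C, hC0, hC⟩ := D.abs_bV_diag_le
  -- The first `ν` pays for replacing `|∇v|²` by `‖v‖²`. The other two terms are the remainders of
  -- Young's inequality for the viscous and convective background terms, each of which takes `ν / 4`
  -- of `‖v‖²`.
  refine ⟨ν + ν * ‖ξ‖ ^ 2 + C ^ 2 * ‖ξ‖ ^ 2 / ν, by positivity, fun g v h => ?_⟩
  have h1 : D.forcing ν U v (0 - v) ≤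
    g (0 - v) + ν * D.aForm (D.grad v) (D.grad (0 - v)) + D.bV v v (0 - v) + D.j k 0 - D.j k v :=
    h 0
  have hj := D.j_nonneg hk.le v
  have eg : D.grad (0 - v) = 0 - D.grad v := rfl
  rw [hξ, D.bV_sub_right, D.bV_sub_right, D.bV_sub_right, D.bV_self, D.bV_self, D.bV_zero_right,
    D.bV_zero_right, D.bV_zero_right, D.j_zero, D.aForm_grad, eg, inner_sub_right,
    inner_sub_right, inner_zero_right, inner_zero_right, map_sub, map_zero,
    real_inner_self_eq_norm_sq] at h1
  have hn := D.norm_sq_eq v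
  have hb := (abs_le.1 (hC v ξ)).1
  have hi : -(‖ξ‖ * ‖v‖) ≤ inner ℝ (D.grad ξ) (D.grad v) := by
    have e1 := (abs_le.1 (abs_real_inner_le_norm (D.grad ξ) (D.grad v))).1
    have e2 := mul_le_mul (D.norm_grad_le ξ) (D.norm_grad_le v) (norm_nonneg _) (norm_nonneg _)
    linarith
  have hi' := mul_le_mul_of_nonneg_left hi hν.le
  have y1 : ν * (‖ξ‖ * ‖v‖) ≤ ν / 4 * ‖v‖ ^ 2 + ν * ‖ξ‖ ^ 2 := by
    nlinarith [mul_nonneg hν.le (sq_nonneg (‖v‖ / 2 - ‖ξ‖))]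
  have y2 : C * (‖D.toH v‖ * ‖v‖ * ‖ξ‖) ≤
      ν / 4 * ‖v‖ ^ 2 + C ^ 2 * ‖ξ‖ ^ 2 / ν * ‖D.toH v‖ ^ 2 := by
    have e : ν / 4 * ‖v‖ ^ 2 + C ^ 2 * ‖ξ‖ ^ 2 / ν * ‖D.toH v‖ ^ 2 -
        C * (‖D.toH v‖ * ‖v‖ * ‖ξ‖) = (ν * ‖v‖ / 2 - C * ‖ξ‖ * ‖D.toH v‖) ^ 2 / ν := by
      field_simp
      ring
    have : 0 ≤ (ν * ‖v‖ / 2 - C * ‖ξ‖ * ‖D.toH v‖) ^ 2 / ν := by positivity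
    linarith
  have y3 : 0 ≤ ν * ‖ξ‖ ^ 2 * ‖D.toH v‖ ^ 2 := by positivity
  have y4 : 0 ≤ C ^ 2 * ‖ξ‖ ^ 2 / ν := by positivity
  nlinarith

/-- The stability estimate at a fixed time for the difference of two solutions. -/
theorem VarIneq.stability {U₀ : ℝ} {U : ℝ → ℝ} (hU : D.IsBackground U₀ U) {ν k : ℝ}
    (hν : 0 < ν) : ∃ A : ℝ, 0 ≤ A ∧ ∀ (g₁ g₂ : D.VDual) (v w : D.V), D.VarIneq ν k U g₁ v →
      D.VarIneq ν k U g₂ w →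
      (g₂ - g₁) (w - v) ≤ A * (1 + ‖v‖ ^ 2) * ‖D.toH (w - v)‖ ^ 2 := by
  obtain ⟨ξ, hξ⟩ := D.exists_forcing_eq hU ν
  obtain ⟨C, hC0, hC⟩ := D.abs_bV_diag_le
  refine ⟨ν + C ^ 2 * ‖ξ‖ ^ 2 / (2 * ν) + C ^ 2 / (2 * ν), by positivity,
    fun g₁ g₂ v w h₁ h₂ => ?_⟩
  have h1 : D.forcing ν U v (w - v) ≤ g₁ (w - v) + ν * D.aForm (D.grad v) (D.grad (w - v)) +
    D.bV v v (w - v) + D.j k w - D.j k v := h₁ w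
  have h2 : D.forcing ν U w (v - w) ≤ g₂ (v - w) + ν * D.aForm (D.grad w) (D.grad (v - w)) +
    D.bV w w (v - w) + D.j k v - D.j k w := h₂ v
  have eb : ∀ a b : D.V, D.bV a b (v - w) = -D.bV a b (w - v) := fun a b => by
    rw [D.bV_sub_right, D.bV_sub_right]; ring
  have eg : D.grad (v - w) = -D.grad (w - v) :=
    (neg_sub (D.grad w) (D.grad v)).symm
  have egg : g₂ (v - w) = -g₂ (w - v) := by rw [← map_neg, neg_sub]
  have hz : D.grad (w - v) = D.grad w - D.grad v := rfl
  rw [hξ, D.aForm_grad] at h1 h2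
  rw [eb, eb, eb, eg, inner_neg_right, inner_neg_right, egg] at h2
  set z := w - v with hzdef
  have e1 : inner ℝ (D.grad w) (D.grad z) - inner ℝ (D.grad v) (D.grad z) = ‖D.grad z‖ ^ 2 := by
    rw [← inner_sub_left, ← hz, real_inner_self_eq_norm_sq]
  have e2 : D.bV w w z - D.bV v v z = D.bV z v z := by
    have q1 := D.bV_self w z
    have q2 := D.bV_sub_left w v v z
    have q3 := D.bV_sub_mid w w v z
    rw [← hzdef] at q2 q3
    linarith
  -- Transport of the difference by the background flow contributes `b(ξ, z, z) = 0`.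
  have e3 : D.bV ξ w z = D.bV ξ v z := by
    have q1 := D.bV_self ξ z
    have q3 := D.bV_sub_mid ξ w v z
    rw [← hzdef] at q3
    linarith
  have e4 : D.bV w ξ z - D.bV v ξ z = D.bV z ξ z := (D.bV_sub_left w v ξ z).symm
  have hn := D.norm_sq_eq z
  have hb1 := (abs_le.1 (hC z v)).1
  have hb2 := (abs_le.1 (hC z ξ)).1
  have e1' := congrArg (ν * ·) e1
  simp only [mul_sub] at e1'
  have eS : (g₂ - g₁) z = g₂ z - g₁ z := rfl
  -- Used for `x = ‖v‖` and `x = ‖ξ‖`; the two shares `ν / 2` together use up exactly the viscous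
  -- term `ν ‖z‖²`.
  have young : ∀ x : ℝ, C * (‖D.toH z‖ * ‖z‖ * x) ≤
      ν / 2 * ‖z‖ ^ 2 + C ^ 2 * x ^ 2 / (2 * ν) * ‖D.toH z‖ ^ 2 := fun x => by
    have e : ν / 2 * ‖z‖ ^ 2 + C ^ 2 * x ^ 2 / (2 * ν) * ‖D.toH z‖ ^ 2 -
        C * (‖D.toH z‖ * ‖z‖ * x) = (ν * ‖z‖ - C * x * ‖D.toH z‖) ^ 2 / (2 * ν) := by
      field_simp
      ring
    have : 0 ≤ (ν * ‖z‖ - C * x * ‖D.toH z‖) ^ 2 / (2 * ν) := by positivity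
    linarith
  have y1 := young ‖v‖
  have y2 := young ‖ξ‖
  have key : (g₂ - g₁) z ≤ (ν + C ^ 2 * ‖ξ‖ ^ 2 / (2 * ν) + C ^ 2 / (2 * ν) * ‖v‖ ^ 2) *
      ‖D.toH z‖ ^ 2 := by
    rw [eS]
    have : C ^ 2 * ‖v‖ ^ 2 / (2 * ν) = C ^ 2 / (2 * ν) * ‖v‖ ^ 2 := by ring
    rw [this] at y1
    nlinarith
  refine key.trans (mul_le_mul_of_nonneg_right ?_ (sq_nonneg _))
  have p1 : 0 ≤ (ν + C ^ 2 * ‖ξ‖ ^ 2 / (2 * ν)) * ‖v‖ ^ 2 := by positivity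
  have p2 : 0 ≤ C ^ 2 / (2 * ν) := by positivity
  nlinarith

/-! ### Solutions in time: a priori bound and Lipschitz dependence -/

/-- The properties of a solution on `(0, T)` in the form in which they are used. -/
structure SolutionOn (ν k : ℝ) (U : ℝ → ℝ) (T : ℝ) (v : ℝ → D.H) (vV : ℝ → D.V)
    (vt : ℝ → D.VDual) : Prop where
  cont : ContinuousOn v (Icc 0 T)
  memV : MemLp vV 2 (volume.restrict (Ioo 0 T))
  toH_eq : ∀ᵐ t ∂(volume.restrict (Ioo 0 T)), D.toH (vV t) = v t
  memDual : MemLp vt 2 (volume.restrict (Ioo 0 T))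
  prim : ∀ a b, 0 ≤ a → a ≤ b → b ≤ T → ∀ Θ : D.V,
    inner ℝ (v b) (D.toH Θ) - inner ℝ (v a) (D.toH Θ) = ∫ r in a..b, vt r Θ
  ineq : ∀ᵐ t ∂(volume.restrict (Ioo 0 T)), D.VarIneq ν k U (vt t) (vV t)

variable {D} {ν k U₀ : ℝ} {U : ℝ → ℝ}

/-- The exceptional null set of times may depend on `Θ`. A countable dense set of test functions
gives one null set for all of them, and density then gives every `Θ`, including a `Θ` chosen as a
function of time. -/
theorem IsSolution.exists_solutionOn (hU : D.IsBackground U₀ U) {v₀ : D.H} {v : ℝ → D.H}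
    (hv : D.IsSolution ν k U v₀ v) :
    v 0 = v₀ ∧ ∃ (vV : ℝ → D.V) (vt : ℝ → D.VDual), ∀ T > 0, D.SolutionOn ν k U T v vV vt := by
  obtain ⟨vV, vt, hreg, hineq, h0⟩ := hv
  refine ⟨h0, vV, vt, fun T hT => ?_⟩
  obtain ⟨h1, h2, h3, h4, h5⟩ := hreg T hT
  refine ⟨h1, h2, h3, h4, fun a b ha hab hb Θ =>
    IsWeakTimeDeriv.inner_sub_inner_eq D hT h1 h4 h5 ha hab hb Θ, ?_⟩
  have := D.separableSpace_V
  obtain ⟨S, hSc, hSd⟩ := TopologicalSpace.exists_countable_dense D.V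
  filter_upwards [(ae_ball_iff hSc).2 fun Θ _ => hineq Θ T hT] with t ht
  exact D.varIneq_of_dense hU hSd ht

namespace SolutionOn

variable {T : ℝ} {v w : ℝ → D.H} {vV wV : ℝ → D.V} {vt wt : ℝ → D.VDual}

theorem integrableOn_norm_sq (h : D.SolutionOn ν k U T v vV vt) :
    IntegrableOn (fun t => ‖vV t‖ ^ 2) (Ioo 0 T) :=
  h.memV.integrable_norm_pow two_ne_zero

/-- The a priori bound of a solution in `L²(0, T; V)`. -/
theorem exists_integral_norm_sq_le (hU : D.IsBackground U₀ U) (hν : 0 < ν) (hk : 0 < k) (T R : ℝ)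
    (hT : 0 < T) : ∃ K : ℝ, ∀ (v : ℝ → D.H) (vV : ℝ → D.V) (vt : ℝ → D.VDual),
      (∀ T > 0, D.SolutionOn ν k U T v vV vt) → ‖v 0‖ ≤ R →
      ∫ t in (0 : ℝ)..T, ‖vV t‖ ^ 2 ≤ K := by
  obtain ⟨A, hA, hen⟩ := VarIneq.energy D hU hν hk
  -- The exponential factor is the Gronwall bound for `1 + |v|²` on `[0, T]`, with coefficient `2 *
  -- A`; the energy inequality on `[0, T]` then bounds `ν ∫ ‖v‖²`. The leading `1` is slack.
  refine ⟨(1 + R ^ 2 + T * (2 * A * (Real.exp (2 * (T * (2 * A))) * (1 + R ^ 2)))) / ν,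
    fun v vV vt h hR => ?_⟩
  have hT1 : T < T + 1 := by linarith
  -- The energy identity holds only strictly inside the time interval, so the solution is viewed on
  -- a longer one to reach the endpoint `T`.
  have hsol := h (T + 1) (by linarith)
  have hc : ContinuousOn (fun t => 1 + ‖v t‖ ^ 2) (Icc 0 (T + 1)) :=
    continuousOn_const.add (hsol.cont.norm.pow 2)
  have hi1 : IntegrableOn (fun t => ‖vV t‖ ^ 2) (Ioo 0 (T + 1)) := hsol.integrableOn_norm_sq
  have hi2 : IntegrableOn (fun t => 1 + ‖v t‖ ^ 2) (Ioo 0 (T + 1)) :=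
    (hc.integrableOn_compact isCompact_Icc).mono_set Ioo_subset_Icc_self
  have hsub : ∀ {s t}, 0 ≤ s → s ≤ t → t ≤ T → Ioc s t ⊆ Ioo 0 (T + 1) :=
    fun h0 _ h2 r hr => ⟨h0.trans_lt hr.1, by linarith [hr.2]⟩
  have hI1 : ∀ {s t}, 0 ≤ s → s ≤ t → t ≤ T →
      IntervalIntegrable (fun t => ‖vV t‖ ^ 2) volume s t := fun h0 h1 h2 =>
    (intervalIntegrable_iff_integrableOn_Ioc_of_le h1).2 (hi1.mono_set (hsub h0 h1 h2))
  have hI2 : ∀ {s t}, 0 ≤ s → s ≤ t → t ≤ T →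
      IntervalIntegrable (fun t => 1 + ‖v t‖ ^ 2) volume s t := fun h0 h1 h2 =>
    (intervalIntegrable_iff_integrableOn_Ioc_of_le h1).2 (hi2.mono_set (hsub h0 h1 h2))
  have hstep : ∀ s t, 0 ≤ s → s ≤ t → t ≤ T → ‖v t‖ ^ 2 ≤ ‖v s‖ ^ 2 +
      (2 * A * (∫ r in s..t, (1 + ‖v r‖ ^ 2)) - ν * ∫ r in s..t, ‖vV r‖ ^ 2) := by
    intro s t h0 h1 h2
    rw [← intervalIntegral.integral_const_mul, ← intervalIntegral.integral_const_mul,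
      ← intervalIntegral.integral_sub ((hI2 h0 h1 h2).const_mul _) ((hI1 h0 h1 h2).const_mul _)]
    refine norm_sq_sub_norm_sq_le D.toH hsol.cont hsol.memV hsol.toH_eq hsol.memDual hsol.prim
      ((hi2.const_mul _).sub (hi1.const_mul _)) ?_ h0 h1 (h2.trans_lt hT1)
    filter_upwards [hsol.toH_eq, hsol.ineq] with r hr1 hr2
    have := hen _ _ hr2
    rw [hr1] at this
    simp only [Pi.sub_apply]
    linarith
  have hpos : ∀ {s t}, s ≤ t → 0 ≤ ∫ r in s..t, ‖vV r‖ ^ 2 := fun hst =>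
    intervalIntegral.integral_nonneg hst fun r _ => sq_nonneg _
  have hgr : ∀ t ∈ Icc 0 T, 1 + ‖v t‖ ^ 2 ≤ Real.exp (2 * (T * (2 * A))) * (1 + R ^ 2) := by
    intro t ht
    have := le_exp_mul_of_le_add_integral (y := fun t => 1 + ‖v t‖ ^ 2) (β := fun _ => 2 * A)
      ht.1 (hc.mono (Icc_subset_Icc_right (by linarith [ht.2]))) (fun _ _ => by positivity)
      intervalIntegrable_const (fun _ => by positivity) fun a b h0 h1 h2 => by
        have e := hstep a b h0 h1 (h2.trans ht.2)
        have e2 := mul_nonneg hν.le (hpos h1)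
        rw [intervalIntegral.integral_const_mul]
        linarith
    refine this.trans ?_
    rw [intervalIntegral.integral_const, sub_zero, smul_eq_mul]
    have ht2 := ht.2
    gcongr
  have e0 := hstep 0 T le_rfl hT.le le_rfl
  have e1 : ∫ r in (0 : ℝ)..T, (1 + ‖v r‖ ^ 2) ≤
      T * (Real.exp (2 * (T * (2 * A))) * (1 + R ^ 2)) := by
    refine (intervalIntegral.integral_mono_on hT.le (hI2 le_rfl hT.le le_rfl)
      intervalIntegrable_const hgr).trans (le_of_eq ?_)
    rw [intervalIntegral.integral_const, sub_zero, smul_eq_mul]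
  have e2 := mul_le_mul_of_nonneg_left e1 (mul_nonneg zero_le_two hA)
  have e3 : ‖v 0‖ ^ 2 ≤ R ^ 2 := pow_le_pow_left₀ (norm_nonneg _) hR 2
  rw [le_div_iff₀ hν]
  nlinarith [sq_nonneg ‖v T‖]

/-- The stability estimate for two solutions. -/
theorem exists_norm_sq_sub_le (hU : D.IsBackground U₀ U) (hν : 0 < ν) :
    ∃ A : ℝ, 0 ≤ A ∧ ∀ (v w : ℝ → D.H) (vV wV : ℝ → D.V) (vt wt : ℝ → D.VDual),
      (∀ T > 0, D.SolutionOn ν k U T v vV vt) → (∀ T > 0, D.SolutionOn ν k U T w wV wt) →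
      ∀ τ t : ℝ, 0 ≤ τ → τ ≤ t → ‖w t - v t‖ ^ 2 ≤
        Real.exp (2 * ∫ r in τ..t, 2 * A * (1 + ‖vV r‖ ^ 2)) * ‖w τ - v τ‖ ^ 2 := by
  obtain ⟨A, hA, hst⟩ := VarIneq.stability D (k := k) hU hν
  refine ⟨A, hA, fun v w vV wV vt wt hv hw τ t hτ hτt => ?_⟩
  have hT : 0 < t + 1 := by linarith
  have sv := hv (t + 1) hT
  have sw := hw (t + 1) hT
  have hβ : IntegrableOn (fun r => 2 * A * (1 + ‖vV r‖ ^ 2)) (Ioo 0 (t + 1)) := by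
    refine Integrable.const_mul ?_ _
    exact Integrable.add (integrable_const _) sv.integrableOn_norm_sq
  refine norm_sq_sub_le_exp_mul D.toH_sub sv.cont sw.cont sv.memV sw.memV sv.toH_eq sw.toH_eq
    sv.memDual sw.memDual sv.prim sw.prim hβ (fun r => by positivity) ?_ hτ hτt (lt_add_one t)
  filter_upwards [sv.toH_eq, sw.toH_eq, sv.ineq, sw.ineq] with r h1 h2 h3 h4
  have := hst _ _ _ _ h3 h4
  rw [toH_sub, h1, h2] at this
  linarith

end SolutionOn

/-- The stability exponent involves only the `V` norm of `v`, so a bound on the initial value of `v`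
alone suffices. The square root of the estimate for the squared norms cancels the factor `2` from
Gronwall's inequality. -/
theorem exists_lipschitz_constant (D : PeriodicChannel) (hν : 0 < ν) (hk : 0 < k)
    (hU : D.IsBackground U₀ U) {T : ℝ} (hT : 0 < T) {B : Set D.H} (hB : Bornology.IsBounded B) :
    ∃ C : ℝ, ∀ v₀ ∈ B, ∀ w₀ : D.H, ∀ v w : ℝ → D.H,
      D.IsSolution ν k U v₀ v → D.IsSolution ν k U w₀ w →
      ∀ τ t : ℝ, 0 ≤ τ → τ ≤ t → t ≤ T → ‖w t - v t‖ ≤ C * ‖w τ - v τ‖ := by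
  obtain ⟨R, hR⟩ := hB.exists_norm_le
  obtain ⟨K, hK⟩ := SolutionOn.exists_integral_norm_sq_le hU hν hk T R hT
  obtain ⟨A, hA, hst⟩ := SolutionOn.exists_norm_sq_sub_le (k := k) hU hν
  refine ⟨Real.exp (2 * A * (T + K)), fun v₀ hv₀ w₀ v w hv hw τ t hτ hτt htT => ?_⟩
  obtain ⟨hv0, vV, vt, sv⟩ := hv.exists_solutionOn hU
  obtain ⟨-, wV, wt, sw⟩ := hw.exists_solutionOn hU
  have h1 := hst v w vV wV vt wt sv sw τ t hτ hτt
  have h2 := hK v vV vt sv (hv0 ▸ hR v₀ hv₀)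
  have hi : IntegrableOn (fun r => ‖vV r‖ ^ 2) (Ioo 0 T) := (sv T hT).integrableOn_norm_sq
  have hi0 : IntervalIntegrable (fun r => ‖vV r‖ ^ 2) volume 0 T :=
    (intervalIntegrable_iff_integrableOn_Ioo_of_le hT.le).2 hi
  have h3 : ∫ r in τ..t, 2 * A * (1 + ‖vV r‖ ^ 2) ≤ 2 * A * (T + K) := by
    have e1 : ∫ r in τ..t, 2 * A * (1 + ‖vV r‖ ^ 2) ≤
        ∫ r in (0 : ℝ)..T, 2 * A * (1 + ‖vV r‖ ^ 2) :=
      intervalIntegral.integral_mono_interval hτ hτt htT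
        (ae_of_all _ fun r => by simp only [Pi.zero_apply]; positivity)
        ((intervalIntegrable_const.add hi0).const_mul _)
    have e2 : ∫ r in (0 : ℝ)..T, 2 * A * (1 + ‖vV r‖ ^ 2) =
        2 * A * (T + ∫ r in (0 : ℝ)..T, ‖vV r‖ ^ 2) := by
      rw [intervalIntegral.integral_const_mul, intervalIntegral.integral_add
        intervalIntegrable_const hi0, intervalIntegral.integral_const, sub_zero, smul_eq_mul,
        mul_one]
    rw [e2] at e1
    exact e1.trans (mul_le_mul_of_nonneg_left (by linarith) (by positivity))
  refine (pow_le_pow_iff_left₀ (norm_nonneg _) (by positivity) two_ne_zero).1 (h1.trans ?_)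
  rw [mul_pow, ← Real.exp_nat_mul]
  refine mul_le_mul_of_nonneg_right (Real.exp_le_exp.2 ?_) (sq_nonneg _)
  push_cast
  linarith

end PeriodicChannel
end

theorem mainTheorem4 (D : PeriodicChannel) (ν k U₀ : ℝ) (hν : 0 < ν) (hk : 0 < k)
    (U : ℝ → ℝ) (hU : D.IsBackground U₀ U) :
    (∀ (v₀ : D.H) (v w : ℝ → D.H), D.IsSolution ν k U v₀ v → D.IsSolution ν k U v₀ w →
      Set.EqOn v w (Set.Ici 0)) ∧
    (∀ T > 0, ∀ B : Set D.H, Bornology.IsBounded B → ∃ C : ℝ,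
      ∀ v₀ ∈ B, ∀ w₀ ∈ B, ∀ v w : ℝ → D.H,
        D.IsSolution ν k U v₀ v → D.IsSolution ν k U w₀ w →
        ∀ τ t : ℝ, 0 ≤ τ → τ < t → t ≤ T → ‖w t - v t‖ ≤ C * ‖w τ - v τ‖) := by
  refine ⟨fun v₀ v w hv hw t ht => ?_, fun T hT B hB => ?_⟩
  · have ht0 : (0 : ℝ) ≤ t := ht
    -- The horizon must be positive, while `t` may be zero; hence `t + 1`.
    obtain ⟨C, hC⟩ := D.exists_lipschitz_constant hν hk hU (T := t + 1) (by linarith)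
      (B := {v₀}) Bornology.isBounded_singleton
    have h := hC v₀ rfl v₀ v w hv hw 0 t le_rfl ht0 (by linarith)
    rw [(hv.exists_solutionOn hU).1, (hw.exists_solutionOn hU).1, sub_self, norm_zero, mul_zero,
      norm_le_zero_iff, sub_eq_zero] at h
    exact h.symm
  · obtain ⟨C, hC⟩ := D.exists_lipschitz_constant hν hk hU hT hB
    exact ⟨C, fun v₀ hv₀ w₀ _ v w hv hw τ t hτ hτt htT =>
      hC v₀ hv₀ w₀ v w hv hw τ t hτ hτt.le htT⟩
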